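/- An instance of the seminar assignment problem (SAP) consists of a finite set $I$ of students, a finite set $B$ of seminars, for each $b\in B$ a finite set $K_b\subseteq\mathbb{N}$ with $0\in K_b$, and profits $p(i,b)\in\mathbb{R}$ with $p(i,b)\ge 0$ for $i\in I$, $b\in B$. A seminar assignment is a function $\mathcal{A}:J\to B$ with $J\subseteq I$; it is feasible if $|\mathcal{A}^{-1}(b)|\in K_b$ for all $b\in B$, and its profit is $p(\mathcal{A})=\sum_{i\in J}p(i,\mathcal{A}(i))$. Theorem. The SAP instances in which $|K_b|\le 2$ for all $b\in B$ can be approximated in polynomial time within a factor $1-e^{-1}$: there is a single deterministic algorithm which, for every such instance, halts after a number of steps bounded by a fixed polynomial in $|I|+|B|$ and outputs a feasible assignment $\mathcal{A}$ with $p(\mathcal{A})\ge(1-e^{-1})\,p(\mathcal{A}')$ for every feasible assignment $\mathcal{A}'$. (Steps are those of a random access machine with registers for natural numbers and for real numbers, in which additions, subtractions, comparisons and indexed memory accesses have unit cost, and which has no multiplication, no real constant except $0$ and no rounding.) -/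

import Mathlib

/-!
The seminar assignment problem, and polynomial time on a random access machine.
-/

namespace SAP

/-- An instance of the seminar assignment problem: `n` students, `m` seminars, for every seminar
`b` the set `K b` of allowable numbers of students (always containing `0`), and the profit
`p i b` of assigning student `i` to seminar `b`. -/
structure Inst where
  /-- the number of students -/
  n : ℕ
  /-- the number of seminars -/
  m : ℕ
  /-- the allowable numbers of students -/
  K : Fin m → Finset ℕ
  /-- the profits -/
  p : Fin n → Fin m → ℝ
  /-- a seminar may stay empty -/
  zero_mem : ∀ b, 0 ∈ K b

/-- A seminar assignment: a partial function from the students to the seminars. -/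
abbrev Assignment (P : Inst) : Type := Fin P.n → Option (Fin P.m)

/-- The number of students assigned to each seminar `b` belongs to `K b`. -/
def Feasible (P : Inst) (A : Assignment P) : Prop :=
  ∀ b : Fin P.m, (Finset.univ.filter (fun i => A i = some b)).card ∈ P.K b

/-- The total profit of an assignment; students without a seminar contribute nothing. -/
def profit (P : Inst) (A : Assignment P) : ℝ :=
  ∑ i : Fin P.n, (A i).elim 0 (fun b => P.p i b)

/-! ### The machine model

A random access machine with two kinds of registers: registers for natural numbers and registers
for real numbers. Registers are organised in two-dimensional arrays, `a[i][j]`; the name `a` of an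
array is a literal of the program, the indices `i` and `j` are computed natural numbers.
The only operations on numbers are addition, subtraction (truncated at `0` on natural numbers) and
comparison; the only real constant is `0`, and there is no passage between real and natural numbers
except through the outcome of a comparison. There is no multiplication, so that each operation
lengthens numbers by at most one bit, and unit cost is a realistic measure: on rational data,
polynomially many steps can be simulated by a Turing machine in polynomial time. -/

/-- The memory: the contents of register `a[i][j]`, for both kinds of registers. -/
structure Store where
  /-- registers for natural numbers -/
  nat : ℕ → ℕ → ℕ → ℕ
  /-- registers for real numbers -/
  real : ℕ → ℕ → ℕ → ℝ

/-- Write the natural number `v` to `a[i][j]`. -/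
def Store.writeNat (s : Store) (a i j v : ℕ) : Store where
  nat := fun a' i' j' => if a' = a ∧ i' = i ∧ j' = j then v else s.nat a' i' j'
  real := s.real

/-- Write the real number `v` to `a[i][j]`. -/
noncomputable def Store.writeReal (s : Store) (a i j : ℕ) (v : ℝ) : Store where
  nat := s.nat
  real := fun a' i' j' => if a' = a ∧ i' = i ∧ j' = j then v else s.real a' i' j'

/-- Expressions for natural numbers. -/
inductive NatExpr where
  | const (k : ℕ)
  | get (a : ℕ) (i j : NatExpr)
  | plus (x y : NatExpr)
  | minus (x y : NatExpr)

/-- The value of an expression. -/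
def NatExpr.eval (s : Store) : NatExpr → ℕ
  | .const k => k
  | .get a i j => s.nat a (i.eval s) (j.eval s)
  | .plus x y => x.eval s + y.eval s
  | .minus x y => x.eval s - y.eval s

/-- The number of operations in an expression. -/
def NatExpr.cost : NatExpr → ℕ
  | .const _ => 1
  | .get _ i j => i.cost + j.cost + 1
  | .plus x y => x.cost + y.cost + 1
  | .minus x y => x.cost + y.cost + 1

/-- Expressions for real numbers. -/
inductive RealExpr where
  | zero
  | get (a : ℕ) (i j : NatExpr)
  | plus (x y : RealExpr)
  | minus (x y : RealExpr)

/-- The value of an expression. -/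
noncomputable def RealExpr.eval (s : Store) : RealExpr → ℝ
  | .zero => 0
  | .get a i j => s.real a (i.eval s) (j.eval s)
  | .plus x y => x.eval s + y.eval s
  | .minus x y => x.eval s - y.eval s

/-- The number of operations in an expression. -/
def RealExpr.cost : RealExpr → ℕ
  | .zero => 1
  | .get _ i j => i.cost + j.cost + 1
  | .plus x y => x.cost + y.cost + 1
  | .minus x y => x.cost + y.cost + 1

/-- Tests. -/
inductive Test where
  | natLe (x y : NatExpr)
  | realLe (x y : RealExpr)
  | neg (c : Test)
  | both (c d : Test)

/-- The test succeeds. -/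
def Test.Holds (s : Store) : Test → Prop
  | .natLe x y => x.eval s ≤ y.eval s
  | .realLe x y => x.eval s ≤ y.eval s
  | .neg c => ¬ c.Holds s
  | .both c d => c.Holds s ∧ d.Holds s

/-- The number of operations in a test. -/
def Test.cost : Test → ℕ
  | .natLe x y => x.cost + y.cost + 1
  | .realLe x y => x.cost + y.cost + 1
  | .neg c => c.cost + 1
  | .both c d => c.cost + d.cost + 1

/-- Programs: assignments to registers, composition, branching and while loops. -/
inductive Prog where
  | skip
  | setNat (a : ℕ) (i j v : NatExpr)
  | setReal (a : ℕ) (i j : NatExpr) (v : RealExpr)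
  | seq (c d : Prog)
  | branch (t : Test) (c d : Prog)
  | loop (t : Test) (c : Prog)

/-- `Run c s s' k`: started with memory `s`, the program `c` halts after `k` steps
with memory `s'`. -/
inductive Run : Prog → Store → Store → ℕ → Prop where
  | skip (s : Store) : Run .skip s s 1
  | setNat (a : ℕ) (i j v : NatExpr) (s : Store) :
      Run (.setNat a i j v) s (s.writeNat a (i.eval s) (j.eval s) (v.eval s))
        (i.cost + j.cost + v.cost + 1)
  | setReal (a : ℕ) (i j : NatExpr) (v : RealExpr) (s : Store) :
      Run (.setReal a i j v) s (s.writeReal a (i.eval s) (j.eval s) (v.eval s))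
        (i.cost + j.cost + v.cost + 1)
  | seq {c d : Prog} {s s' s'' : Store} {k l : ℕ} (hc : Run c s s' k) (hd : Run d s' s'' l) :
      Run (.seq c d) s s'' (k + l)
  | branchTrue {t : Test} {c d : Prog} {s s' : Store} {k : ℕ} (ht : t.Holds s)
      (hc : Run c s s' k) : Run (.branch t c d) s s' (t.cost + 1 + k)
  | branchFalse {t : Test} {c d : Prog} {s s' : Store} {k : ℕ} (ht : ¬ t.Holds s)
      (hd : Run d s s' k) : Run (.branch t c d) s s' (t.cost + 1 + k)
  | loopTrue {t : Test} {c : Prog} {s s' s'' : Store} {k l : ℕ} (ht : t.Holds s)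
      (hc : Run c s s' k) (hl : Run (.loop t c) s' s'' l) :
      Run (.loop t c) s s'' (t.cost + 1 + k + l)
  | loopFalse {t : Test} {c : Prog} {s : Store} (ht : ¬ t.Holds s) :
      Run (.loop t c) s s (t.cost + 1)

/-! ### Polynomial-time approximation -/

/-- The memory at the start: among the natural numbers, array `0` holds the number of students,
array `1` the number of seminars, array `2` the elements of `K b` in increasing order in row `b`,
array `3` the size of `K b` in row `b`; among the real numbers, array `0` holds the profits.
All other registers are `0`. -/
noncomputable def input (P : Inst) : Store where
  nat := fun a i j =>
    if a = 0 ∧ i = 0 ∧ j = 0 then P.n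
    else if a = 1 ∧ i = 0 ∧ j = 0 then P.m
    else if h : i < P.m then
      if a = 2 then ((P.K ⟨i, h⟩).sort (· ≤ ·)).getD j 0
      else if a = 3 ∧ j = 0 then (P.K ⟨i, h⟩).card
      else 0
    else 0
  real := fun a i j =>
    if h : a = 0 ∧ i < P.n ∧ j < P.m then P.p ⟨i, h.2.1⟩ ⟨j, h.2.2⟩ else 0

/-- The memory `s` holds the assignment `A` in the first column of array `4` of the natural
numbers: the entry in row `i` is `0` if `A` leaves student `i` unassigned, and it is `b + 1` if `A`
assigns student `i` to seminar `b`. -/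
def Outputs (P : Inst) (s : Store) (A : Assignment P) : Prop :=
  ∀ i : Fin P.n, s.nat 4 i 0 = (A i).elim 0 (fun b => (b : ℕ) + 1)

/-- The instances in the class `C` can be approximated in polynomial time within the factor `α`:
a single program, on every instance in `C`, halts within a number of steps polynomial in the
number of students and seminars, and outputs a feasible assignment whose profit is at least `α`
times the profit of every feasible assignment. -/
def PolyTimeApproximable (C : Set Inst) (α : ℝ) : Prop :=
  ∃ (c : Prog) (q : Polynomial ℕ), ∀ P ∈ C, ∃ (s : Store) (k : ℕ) (A : Assignment P),
    Run c (input P) s k ∧ k ≤ q.eval (P.n + P.m) ∧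
    Outputs P s A ∧ Feasible P A ∧
    ∀ A' : Assignment P, Feasible P A' → α * profit P A' ≤ profit P A

end SAP

/-!
Write `k b` for the positive element of `K b` (or `0` if there is none). A feasible assignment chooses
a set `S` of seminars with `∑ b ∈ S, k b ≤ n` and fills each of them with exactly `k b` students. Let
`value S` be the greatest profit if each `b ∈ S` takes at most `k b` students. Since profits are
nonnegative, places that stay free can be filled afterwards as long as `S` respects the budget `n`
(`exists_fits_exact`), so the problem is to maximize `value` under a budget constraint.

The function `value` is monotone and submodular (`value_submodular`). This follows from linear
programming duality: `value S` is the minimum over nonnegative prices `v` of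
`∑ i, max_c (W i c - v c) + ∑ c, cap c * v c`, the first sum is submodular on the lattice of prices, and
optimal prices for two sets can be replaced by their infimum and supremum. For such functions the
greedy algorithm by marginal value per student, started from every set of at most three seminars,
is within the factor `1 - exp (-1)` of the optimum (`GreedyInvariant.guarantee`). The start that
matters consists of the three elements of an optimal set `O` that are chosen first by marginal value.
While the missing element of `O` of greatest ratio still fits, each step closes the gap to `O` by a
factor `exp (-k x / B)`, where `B` is the budget left by the start; the first such element that does
not fit is worth at most a third of the start (`GreedyStart.dichotomy`).

The values of sets are computed by a primal-dual method (`optimalMatching`). All students start at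
their favourite options at prices `0`. As long as some option is overfull, an alternating tree is grown
from it, with prices raised in the tree by the least amount that makes a student in the tree
indifferent to an option outside, until an option with a free place is reached, and then students are
shifted along the path. Prices always support the assignment (`Supported`), which proves optimality
at the end and, as a by-product, strong duality (`exists_supported_fits`). On the machine the option
"no seminar" is the index `m`, for which the input holds profits `0`, and its capacity `n - ∑ k b`
doubles as the rest of the budget. Ratios of marginal values are compared by repeated addition.

The programs are written with bounded loops only (`ForProg`). Such programs compute a function of the
memory, and halt in polynomial time by induction on their structure (`ForProg.exists_polynomial`).
-/

namespace SAP

/-! ### Programs with bounded loops -/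

/-- The two ranges of loop counters: the students `0, …, n - 1`, and the seminars `0, …, m - 1`
followed by the index `m`, which stands for "no seminar". -/
inductive Range where
  | students
  | seminars

/-- The number of iterations of a loop, as an expression evaluated by the machine. -/
def Range.bound : Range → NatExpr
  | .students => .get 0 (.const 0) (.const 0)
  | .seminars => .plus (.get 1 (.const 0) (.const 0)) (.const 1)

/-- Programs whose only loops are `for x in r`, with the loop counter in register `x[0][0]`. -/
inductive ForProg where
  | skip
  | setNat (a : ℕ) (i j v : NatExpr)
  | setReal (a : ℕ) (i j : NatExpr) (v : RealExpr)
  | seq (c d : ForProg)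
  | branch (t : Test) (c d : ForProg)
  | loop (x : ℕ) (r : Range) (c : ForProg)

namespace ForProg

/-- The program of the machine. -/
def compile : ForProg → Prog
  | skip => .skip
  | setNat a i j v => .setNat a i j v
  | setReal a i j v => .setReal a i j v
  | seq c d => .seq c.compile d.compile
  | branch t c d => .branch t c.compile d.compile
  | loop x r c => .seq (.setNat x (.const 0) (.const 0) (.const 0))
      (.loop (.neg (.natLe r.bound (.get x (.const 0) (.const 0))))
        (.seq c.compile
          (.setNat x (.const 0) (.const 0) (.plus (.get x (.const 0) (.const 0)) (.const 1)))))

open Classical in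
/-- The memory after the execution, as a function of the memory before. -/
noncomputable def run : ForProg → Store → Store
  | skip, s => s
  | setNat a i j v, s => s.writeNat a (i.eval s) (j.eval s) (v.eval s)
  | setReal a i j v, s => s.writeReal a (i.eval s) (j.eval s) (v.eval s)
  | seq c d, s => d.run (c.run s)
  | branch t c d, s => if t.Holds s then c.run s else d.run s
  | loop x r c, s =>
      (fun s' => (c.run s').writeNat x 0 0 ((c.run s').nat x 0 0 + 1))^[r.bound.eval s]
        (s.writeNat x 0 0 0)

/-- The arrays of natural numbers that the program may change. -/
def natWrites : ForProg → List ℕ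
  | skip => []
  | setNat a _ _ _ => [a]
  | setReal _ _ _ _ => []
  | seq c d => c.natWrites ++ d.natWrites
  | branch _ c d => c.natWrites ++ d.natWrites
  | loop x _ c => x :: c.natWrites

/-- The arrays of real numbers that the program may change. -/
def realWrites : ForProg → List ℕ
  | skip => []
  | setNat _ _ _ _ => []
  | setReal a _ _ _ => [a]
  | seq c d => c.realWrites ++ d.realWrites
  | branch _ c d => c.realWrites ++ d.realWrites
  | loop _ _ c => c.realWrites

/-- The program changes neither the numbers of students and seminars nor, inside a loop, the
counter of that loop. -/
def wellFormed : ForProg → Bool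
  | skip => true
  | setNat a _ _ _ => a != 0 && a != 1
  | setReal _ _ _ _ => true
  | seq c d => c.wellFormed && d.wellFormed
  | branch _ c d => c.wellFormed && d.wellFormed
  | loop x _ c => x != 0 && x != 1 && !(c.natWrites.contains x) && c.wellFormed

end ForProg

@[simp] theorem Store.nat_writeNat (s : Store) (a i j v a' i' j' : ℕ) :
    (s.writeNat a i j v).nat a' i' j' =
      if a' = a ∧ i' = i ∧ j' = j then v else s.nat a' i' j' := rfl

@[simp] theorem Store.real_writeNat (s : Store) (a i j v : ℕ) :
    (s.writeNat a i j v).real = s.real := rfl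

@[simp] theorem Store.real_writeReal (s : Store) (a i j : ℕ) (v : ℝ) (a' i' j' : ℕ) :
    (s.writeReal a i j v).real a' i' j' =
      if a' = a ∧ i' = i ∧ j' = j then v else s.real a' i' j' := rfl

@[simp] theorem Store.nat_writeReal (s : Store) (a i j : ℕ) (v : ℝ) :
    (s.writeReal a i j v).nat = s.nat := rfl

attribute [simp] NatExpr.eval RealExpr.eval Test.Holds

namespace ForProg

theorem nat_run_of_notMem (c : ForProg) {a : ℕ} (ha : a ∉ c.natWrites) (s : Store) :
    (c.run s).nat a = s.nat a := by
  induction c generalizing s with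
  | skip => rfl
  | setNat b i j v =>
    have : a ≠ b := by simpa [natWrites] using ha
    funext i' j'
    simp [run, this]
  | setReal b i j v => rfl
  | seq c d hc hd =>
    simp only [natWrites, List.mem_append, not_or] at ha
    simp only [run]
    rw [hd ha.2, hc ha.1]
  | branch t c d hc hd =>
    simp only [natWrites, List.mem_append, not_or] at ha
    simp only [run]
    split_ifs
    · exact hc ha.1 s
    · exact hd ha.2 s
  | loop x r c hc =>
    simp only [natWrites, List.mem_cons, not_or] at ha
    simp only [run]
    have hw : ∀ (t : Store) (v : ℕ), (t.writeNat x 0 0 v).nat a = t.nat a := by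
      intro t v
      funext i' j'
      simp [ha.1]
    generalize r.bound.eval s = N
    induction N with
    | zero => exact hw _ _
    | succ N ih => rw [Function.iterate_succ_apply', hw, hc ha.2, ih]

theorem real_run_of_notMem (c : ForProg) {a : ℕ} (ha : a ∉ c.realWrites) (s : Store) :
    (c.run s).real a = s.real a := by
  induction c generalizing s with
  | skip => rfl
  | setNat b i j v => rfl
  | setReal b i j v =>
    have : a ≠ b := by simpa [realWrites] using ha
    funext i' j'
    simp [run, this]
  | seq c d hc hd =>
    simp only [realWrites, List.mem_append, not_or] at ha
    simp only [run]
    rw [hd ha.2, hc ha.1]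
  | branch t c d hc hd =>
    simp only [realWrites, List.mem_append, not_or] at ha
    simp only [run]
    split_ifs
    · exact hc ha.1 s
    · exact hd ha.2 s
  | loop x r c hc =>
    simp only [realWrites] at ha
    simp only [run]
    generalize r.bound.eval s = N
    induction N with
    | zero => rfl
    | succ N ih => rw [Function.iterate_succ_apply', Store.real_writeNat, hc ha, ih]

theorem notMem_natWrites {c : ForProg} (hc : c.wellFormed) :
    0 ∉ c.natWrites ∧ 1 ∉ c.natWrites := by
  induction c with
  | skip => simp [natWrites]
  | setNat b i j v =>
    simp only [wellFormed, Bool.and_eq_true, bne_iff_ne] at hc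
    simpa [natWrites] using ⟨hc.1.symm, hc.2.symm⟩
  | setReal b i j v => simp [natWrites]
  | seq c d ihc ihd =>
    simp only [wellFormed, Bool.and_eq_true] at hc
    simp [natWrites, ihc hc.1, ihd hc.2]
  | branch t c d ihc ihd =>
    simp only [wellFormed, Bool.and_eq_true] at hc
    simp [natWrites, ihc hc.1, ihd hc.2]
  | loop x r c ih =>
    simp only [wellFormed, Bool.and_eq_true, bne_iff_ne] at hc
    simp [natWrites, ih hc.2, hc.1.1.1.symm, hc.1.1.2.symm]

theorem bound_eval_congr (r : Range) {s s' : Store} (h0 : s'.nat 0 = s.nat 0)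
    (h1 : s'.nat 1 = s.nat 1) : r.bound.eval s' = r.bound.eval s := by
  cases r <;> simp [Range.bound, h0, h1]

/-- A program with bounded loops halts after a number of steps that is polynomial in the numbers of
students and seminars: the polynomial can be read off from the nesting of the loops. -/
theorem exists_polynomial (c : ForProg) (hc : c.wellFormed) :
    ∃ q : Polynomial ℕ, ∀ s : Store, ∃ k ≤ q.eval (s.nat 0 0 0 + s.nat 1 0 0),
      Run c.compile s (c.run s) k := by
  induction c with
  | skip => exact ⟨1, fun s => ⟨1, by simp, .skip s⟩⟩
  | setNat a i j v =>
    exact ⟨Polynomial.C (i.cost + j.cost + v.cost + 1), fun s => ⟨_, by simp, .setNat a i j v s⟩⟩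
  | setReal a i j v =>
    exact ⟨Polynomial.C (i.cost + j.cost + v.cost + 1), fun s => ⟨_, by simp, .setReal a i j v s⟩⟩
  | seq c d ihc ihd =>
    simp only [wellFormed, Bool.and_eq_true] at hc
    obtain ⟨q, hq⟩ := ihc hc.1
    obtain ⟨q', hq'⟩ := ihd hc.2
    refine ⟨q + q', fun s => ?_⟩
    obtain ⟨k, hk, hrun⟩ := hq s
    obtain ⟨k', hk', hrun'⟩ := hq' (c.run s)
    obtain ⟨h0, h1⟩ := notMem_natWrites hc.1
    rw [nat_run_of_notMem c h0, nat_run_of_notMem c h1] at hk'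
    exact ⟨k + k', by rw [Polynomial.eval_add]; omega, hrun.seq hrun'⟩
  | branch t c d ihc ihd =>
    simp only [wellFormed, Bool.and_eq_true] at hc
    obtain ⟨q, hq⟩ := ihc hc.1
    obtain ⟨q', hq'⟩ := ihd hc.2
    refine ⟨Polynomial.C (t.cost + 1) + q + q', fun s => ?_⟩
    simp only [Polynomial.eval_add, Polynomial.eval_C]
    by_cases ht : t.Holds s
    · obtain ⟨k, hk, hrun⟩ := hq s
      refine ⟨t.cost + 1 + k, by omega, ?_⟩
      simpa only [compile, run, if_pos ht] using Run.branchTrue ht hrun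
    · obtain ⟨k, hk, hrun⟩ := hq' s
      refine ⟨t.cost + 1 + k, by omega, ?_⟩
      simpa only [compile, run, if_neg ht] using Run.branchFalse ht hrun
  | loop x r c ih =>
    simp only [wellFormed, Bool.and_eq_true, bne_iff_ne, Bool.not_eq_true', List.contains_eq_mem,
      decide_eq_false_iff_not] at hc
    obtain ⟨⟨⟨hx0, hx1⟩, hx⟩, hc⟩ := hc
    obtain ⟨q, hq⟩ := ih hc
    set t : Test := .neg (.natLe r.bound (.get x (.const 0) (.const 0))) with ht
    set body : Prog := .seq c.compile
          (.setNat x (.const 0) (.const 0) (.plus (.get x (.const 0) (.const 0)) (.const 1)))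
      with hbody
    set F : Store → Store := fun s' => (c.run s').writeNat x 0 0 ((c.run s').nat x 0 0 + 1) with hF
    refine ⟨Polynomial.C 4 + ((Polynomial.X + 1) * (Polynomial.C (t.cost + 1 + 8) + q) +
      Polynomial.C (t.cost + 1)), fun s => ?_⟩
    have hF0 : ∀ s', (F s').nat 0 = s'.nat 0 := fun s' => by
      funext i j; simp [hF, hx0.symm, nat_run_of_notMem c (notMem_natWrites hc).1]
    have hF1 : ∀ s', (F s').nat 1 = s'.nat 1 := fun s' => by
      funext i j; simp [hF, hx1.symm, nat_run_of_notMem c (notMem_natWrites hc).2]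
    have hFx : ∀ s', (F s').nat x 0 0 = s'.nat x 0 0 + 1 := fun s' => by
      simp [hF, nat_run_of_notMem c hx]
    have key : ∀ (N : ℕ) (s' : Store), s'.nat x 0 0 + N = r.bound.eval s' →
        ∃ k ≤ N * (t.cost + 1 + 8 + q.eval (s'.nat 0 0 0 + s'.nat 1 0 0)) + (t.cost + 1),
          Run (.loop t body) s' (F^[N] s') k := by
      intro N
      induction N with
      | zero =>
        intro s' hs'
        refine ⟨t.cost + 1, by omega, Run.loopFalse ?_⟩
        simp only [ht, Test.Holds, NatExpr.eval, not_not]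
        omega
      | succ N ihN =>
        intro s' hs'
        obtain ⟨k, hk, hrun⟩ := hq s'
        have hb : r.bound.eval (F s') = r.bound.eval s' := bound_eval_congr r (hF0 s') (hF1 s')
        obtain ⟨k', hk', hrun'⟩ := ihN (F s') (by rw [hb, hFx]; omega)
        have hrunbody : Run body s' (F s') (k + 8) := hrun.seq (.setNat _ _ _ _ _)
        refine ⟨t.cost + 1 + (k + 8) + k', ?_, ?_⟩
        · rw [hF0, hF1] at hk'
          rw [Nat.succ_mul]
          omega
        · rw [Function.iterate_succ_apply]
          refine Run.loopTrue ?_ hrunbody hrun'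
          simp only [ht, Test.Holds, NatExpr.eval]
          omega
    set s₀ := s.writeNat x 0 0 0 with hs₀
    have h0 : s₀.nat 0 = s.nat 0 := by funext i j; simp [hs₀, hx0.symm]
    have h1 : s₀.nat 1 = s.nat 1 := by funext i j; simp [hs₀, hx1.symm]
    obtain ⟨k, hk, hrun⟩ := key (r.bound.eval s) s₀ (by
      rw [bound_eval_congr r h0 h1]; simp [hs₀])
    refine ⟨4 + k, ?_, Run.seq (.setNat _ _ _ _ _) hrun⟩
    rw [h0, h1] at hk
    have hbd : r.bound.eval s ≤ s.nat 0 0 0 + s.nat 1 0 0 + 1 := by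
      rcases r with _ | _
      all_goals (simp only [Range.bound, NatExpr.eval]; omega)
    have := Nat.mul_le_mul_right
      (t.cost + 1 + 8 + q.eval (s.nat 0 0 0 + s.nat 1 0 0)) hbd
    simp only [Polynomial.eval_add, Polynomial.eval_mul, Polynomial.eval_C, Polynomial.eval_X,
      Polynomial.eval_one]
    omega

/-- Induction over the iterations of a loop. In the `j`-th iteration the counter is `j`, and the
arrays that the loop does not change are as they were at the start. -/
theorem run_loop_induct {x : ℕ} {r : Range} {c : ForProg} (hwf : (loop x r c).wellFormed)
    (s : Store) (I : ℕ → Store → Prop) (h0 : I 0 (s.writeNat x 0 0 0))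
    (hstep : ∀ j < r.bound.eval s, ∀ s' : Store, I j s' → s'.nat x 0 0 = j →
      (∀ a ∉ (loop x r c).natWrites, s'.nat a = s.nat a) →
      (∀ a ∉ (loop x r c).realWrites, s'.real a = s.real a) →
      I (j + 1) ((c.run s').writeNat x 0 0 (j + 1))) :
    I (r.bound.eval s) ((loop x r c).run s) := by
  simp only [wellFormed, Bool.and_eq_true, bne_iff_ne, Bool.not_eq_true', List.contains_eq_mem,
      decide_eq_false_iff_not] at hwf
  obtain ⟨⟨⟨hx0, hx1⟩, hx⟩, hc⟩ := hwf
  set F : Store → Store := fun s' => (c.run s').writeNat x 0 0 ((c.run s').nat x 0 0 + 1) with hF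
  have key : ∀ N ≤ r.bound.eval s, I N (F^[N] (s.writeNat x 0 0 0)) ∧
      (F^[N] (s.writeNat x 0 0 0)).nat x 0 0 = N ∧
      (∀ a ∉ (loop x r c).natWrites, (F^[N] (s.writeNat x 0 0 0)).nat a = s.nat a) ∧
      (∀ a ∉ (loop x r c).realWrites, (F^[N] (s.writeNat x 0 0 0)).real a = s.real a) := by
    intro N
    induction N with
    | zero =>
      refine fun _ => ⟨h0, by simp, fun a ha => ?_, fun a _ => rfl⟩
      simp only [natWrites, List.mem_cons, not_or] at ha
      funext i j
      simp [ha.1]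
    | succ N ih =>
      intro hN
      obtain ⟨hI, hxN, hn, hr⟩ := ih (by omega)
      rw [Function.iterate_succ_apply']
      generalize F^[N] (s.writeNat x 0 0 0) = s' at *
      have hxc : (c.run s').nat x 0 0 = N := by rw [nat_run_of_notMem c hx, hxN]
      refine ⟨?_, by simp [hF, hxc], fun a ha => ?_, fun a ha => ?_⟩
      · simp only [hF, hxc]
        exact hstep N (by omega) s' hI hxN hn hr
      · rw [← hn a ha]
        simp only [natWrites, List.mem_cons, not_or] at ha
        funext i j
        simp [hF, ha.1, nat_run_of_notMem c ha.2]
      · rw [← hr a ha]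
        exact real_run_of_notMem c ha s'
  exact (key _ le_rfl).1

end ForProg

open Finset

/-! ### Assignments with capacities and their duality -/

/-! There are `n` students `0, …, n - 1` and `m + 1` options `0, …, m`. In the application the
options `c < m` are the seminars, and the option `m` is to stay without a seminar. -/

section Duality

/-- The number of students `i < n` whom `A` sends to `c`. Assignments are encoded as functions on
`ℕ`, of which only the values at `0, …, n - 1` matter. -/
def load (n : ℕ) (A : ℕ → ℕ) (c : ℕ) : ℕ := ((range n).filter (fun i => A i = c)).card

/-- The total weight of `A`. -/
def gain (n : ℕ) (W : ℕ → ℕ → ℝ) (A : ℕ → ℕ) : ℝ := ∑ i ∈ range n, W i (A i)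

/-- `A` sends each of the students `0, …, n - 1` to one of `0, …, m`, and at most `cap c` of them
to `c`. -/
structure Fits (n m : ℕ) (cap A : ℕ → ℕ) : Prop where
  le : ∀ i < n, A i ≤ m
  load_le : ∀ c ≤ m, load n A c ≤ cap c

/-- The prices `v` support the map `A`: each student is sent to an option of greatest net value,
prices are nonnegative, and an option with free places has price `0`. This does not say that `A`
respects the capacities. -/
structure Supported (n m : ℕ) (W : ℕ → ℕ → ℝ) (cap A : ℕ → ℕ) (v : ℕ → ℝ) : Prop where
  le : ∀ i < n, A i ≤ m
  best : ∀ i < n, ∀ c ≤ m, W i c - v c ≤ W i (A i) - v (A i)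
  nonneg : ∀ c ≤ m, 0 ≤ v c
  price_eq_zero : ∀ c ≤ m, load n A c < cap c → v c = 0

/-- The greatest net value that student `i` can obtain at the prices `v`. -/
def utility (m : ℕ) (W : ℕ → ℕ → ℝ) (v : ℕ → ℝ) (i : ℕ) : ℝ :=
  (range (m + 1)).sup' nonempty_range_add_one (fun c => W i c - v c)

/-- The value of the prices `v` in the linear program dual to the assignment problem. -/
def dualValue (n m : ℕ) (W : ℕ → ℕ → ℝ) (cap : ℕ → ℕ) (v : ℕ → ℝ) : ℝ :=
  ∑ i ∈ range n, utility m W v i + ∑ c ∈ range (m + 1), cap c * v c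

/-- The greatest weight of an assignment that respects the capacities. -/
noncomputable def optimum (n m : ℕ) (W : ℕ → ℕ → ℝ) (cap : ℕ → ℕ) : ℝ :=
  sSup {g | ∃ A, Fits n m cap A ∧ gain n W A = g}

variable {n m : ℕ} {W : ℕ → ℕ → ℝ} {cap A : ℕ → ℕ} {v : ℕ → ℝ}

theorem sum_load (hA : ∀ i < n, A i ≤ m) : ∑ c ∈ range (m + 1), load n A c = n := by
  have := card_eq_sum_card_fiberwise (s := range n) (t := range (m + 1)) (f := A)
    (fun i hi => by simpa [Nat.lt_succ_iff] using hA i (by simpa using hi))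
  simpa [load] using this.symm

theorem sum_price (hA : ∀ i < n, A i ≤ m) :
    ∑ i ∈ range n, v (A i) = ∑ c ∈ range (m + 1), (load n A c : ℝ) * v c := by
  rw [← sum_fiberwise_of_maps_to (s := range n) (t := range (m + 1)) (g := A)
    (fun i hi => by simpa [Nat.lt_succ_iff] using hA i (by simpa using hi))]
  refine sum_congr rfl fun c _ => ?_
  rw [sum_congr rfl (g := fun _ => v c) (fun i hi => by rw [(mem_filter.1 hi).2])]
  simp [load]

theorem le_utility (i : ℕ) {c : ℕ} (hc : c ≤ m) : W i c - v c ≤ utility m W v i :=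
  le_sup' (fun c => W i c - v c) (by simpa [Nat.lt_succ_iff] using hc)

theorem utility_le {i : ℕ} {u : ℝ} (h : ∀ c ≤ m, W i c - v c ≤ u) : utility m W v i ≤ u :=
  sup'_le _ _ fun c hc => h c (by simpa [Nat.lt_succ_iff] using hc)

/-- Weak duality. -/
theorem gain_le_dualValue (hA : Fits n m cap A) (hv : ∀ c ≤ m, 0 ≤ v c) :
    gain n W A ≤ dualValue n m W cap v := by
  have h1 : gain n W A ≤ ∑ i ∈ range n, (utility m W v i + v (A i)) :=
    sum_le_sum fun i hi => by
      linarith [le_utility (W := W) (v := v) i (hA.le i (mem_range.1 hi))]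
  rw [sum_add_distrib, sum_price hA.le] at h1
  refine h1.trans (add_le_add le_rfl (sum_le_sum fun c hc => ?_))
  have hc' : c ≤ m := by simpa [Nat.lt_succ_iff] using hc
  exact mul_le_mul_of_nonneg_right (by exact_mod_cast hA.load_le c hc') (hv c hc')

/-- Complementary slackness. -/
theorem Supported.gain_eq_dualValue (hS : Supported n m W cap A v) (hA : Fits n m cap A) :
    gain n W A = dualValue n m W cap v := by
  have h1 : gain n W A = ∑ i ∈ range n, (utility m W v i + v (A i)) :=
    sum_congr rfl fun i hi => by
      have hi := mem_range.1 hi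
      have := le_antisymm (le_utility (W := W) (v := v) i (hS.le i hi)) (utility_le (hS.best i hi))
      linarith
  rw [h1, sum_add_distrib, sum_price hA.le]
  refine congrArg₂ (· + ·) rfl (sum_congr rfl fun c hc => ?_)
  have hc' : c ≤ m := by simpa [Nat.lt_succ_iff] using hc
  rcases (hA.load_le c hc').lt_or_eq with h | h
  · simp [hS.price_eq_zero c hc' h]
  · rw [h]

theorem gain_le_optimum (hA : Fits n m cap A) : gain n W A ≤ optimum n m W cap :=
  le_csSup ⟨dualValue n m W cap 0, by
    rintro _ ⟨A', hA', rfl⟩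
    exact gain_le_dualValue hA' fun _ _ => le_rfl⟩ ⟨A, hA, rfl⟩

theorem optimum_le {u : ℝ} (h0 : ∃ A, Fits n m cap A)
    (h : ∀ A, Fits n m cap A → gain n W A ≤ u) : optimum n m W cap ≤ u := by
  obtain ⟨A, hA⟩ := h0
  refine csSup_le ⟨_, A, hA, rfl⟩ ?_
  rintro _ ⟨A', hA', rfl⟩
  exact h A' hA'

theorem Supported.optimum_eq (hS : Supported n m W cap A v) (hA : Fits n m cap A) :
    optimum n m W cap = dualValue n m W cap v :=
  le_antisymm (optimum_le ⟨A, hA⟩ fun _ h => gain_le_dualValue h hS.nonneg)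
    (hS.gain_eq_dualValue hA ▸ gain_le_optimum hA)

theorem Supported.gain_eq_optimum (hS : Supported n m W cap A v) (hA : Fits n m cap A) :
    gain n W A = optimum n m W cap := by
  rw [hS.optimum_eq hA, hS.gain_eq_dualValue hA]

/-- The capacities when the seminars of `S` are held: `k c` for `c ∈ S`, and no seminar takes
anybody for `c ∉ S`. The option `m`, to stay without a seminar, has capacity `r`. -/
def capacity (m : ℕ) (k : ℕ → ℕ) (r : ℕ) (S : Finset ℕ) (c : ℕ) : ℕ :=
  if c = m then r else if c ∈ S then k c else 0

/-- The greatest total weight if the seminars of `S` are held with at most `k c` students each.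
The option `m` is never exhausted, since `n + 1` places are provided. -/
noncomputable def value (n m : ℕ) (W : ℕ → ℕ → ℝ) (k : ℕ → ℕ) (S : Finset ℕ) : ℝ :=
  optimum n m W (capacity m k (n + 1) S)

variable {k : ℕ → ℕ}

theorem fits_const (S : Finset ℕ) : Fits n m (capacity m k (n + 1) S) (fun _ => m) where
  le _ _ := le_rfl
  load_le c _ := by
    by_cases hc : c = m
    · simp [load, capacity, hc]
    · simp [load, Ne.symm hc]

theorem value_nonneg (hW : ∀ i c, 0 ≤ W i c) (S : Finset ℕ) : 0 ≤ value n m W k S :=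
  (sum_nonneg fun i _ => hW i m).trans (gain_le_optimum (fits_const S))

theorem value_mono {S T : Finset ℕ} (h : S ⊆ T) : value n m W k S ≤ value n m W k T := by
  refine optimum_le ⟨_, fits_const S⟩ fun A hA => gain_le_optimum ⟨hA.le, fun c hc => ?_⟩
  refine (hA.load_le c hc).trans ?_
  unfold capacity
  split_ifs with h1 h2 h3 <;> first | exact le_rfl | exact Nat.zero_le _ | exact absurd (h h2) h3

theorem utility_inf_add_sup_le (v w : ℕ → ℝ) (i : ℕ) :
    utility m W (v ⊓ w) i + utility m W (v ⊔ w) i ≤ utility m W v i + utility m W w i := by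
  have h1 : utility m W (v ⊓ w) i ≤ max (utility m W v i) (utility m W w i) :=
    utility_le fun c hc => by
      have hv := le_utility (W := W) (v := v) i hc
      have hw := le_utility (W := W) (v := w) i hc
      rcases le_total (v c) (w c) with h | h
      · simp only [Pi.inf_apply, inf_eq_left.2 h]
        exact hv.trans (le_max_left _ _)
      · simp only [Pi.inf_apply, inf_eq_right.2 h]
        exact hw.trans (le_max_right _ _)
  have h2 : utility m W (v ⊔ w) i ≤ min (utility m W v i) (utility m W w i) :=
    utility_le fun c hc => by
      have hv := le_utility (W := W) (v := v) i hc
      have hw := le_utility (W := W) (v := w) i hc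
      have h3 : v c ≤ (v ⊔ w) c := le_sup_left
      have h4 : w c ≤ (v ⊔ w) c := le_sup_right
      exact le_min (by linarith) (by linarith)
  linarith [max_add_min (utility m W v i) (utility m W w i)]

/-- The marginal value of a seminar decreases as more seminars are held. If `v` and `w` are optimal
prices for `T` and for `S ∪ {x}`, then `v ⊓ w` and `v ⊔ w` are admissible prices for `T ∪ {x}` and
for `S`, and the dual value is submodular in the prices. -/
theorem value_submodular
    (hdual : ∀ S : Finset ℕ, ∃ A v, Supported n m W (capacity m k (n + 1) S) A v ∧
      Fits n m (capacity m k (n + 1) S) A)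
    {S T : Finset ℕ} (h : S ⊆ T) {x : ℕ} (hx : x ∉ T) :
    value n m W k (insert x T) + value n m W k S ≤
      value n m W k T + value n m W k (insert x S) := by
  obtain ⟨A, v, hS, hA⟩ := hdual T
  obtain ⟨B, w, hS', hB⟩ := hdual (insert x S)
  have e1 : value n m W k T = _ := hS.optimum_eq hA
  have e2 : value n m W k (insert x S) = _ := hS'.optimum_eq hB
  have l1 : value n m W k (insert x T) ≤
      dualValue n m W (capacity m k (n + 1) (insert x T)) (v ⊓ w) :=
    optimum_le ⟨_, fits_const _⟩ fun _ h => gain_le_dualValue h fun c hc =>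
      le_inf (hS.nonneg c hc) (hS'.nonneg c hc)
  have l2 : value n m W k S ≤ dualValue n m W (capacity m k (n + 1) S) (v ⊔ w) :=
    optimum_le ⟨_, fits_const _⟩ fun _ h => gain_le_dualValue h fun c hc =>
      (hS.nonneg c hc).trans le_sup_left
  rw [e1, e2]
  refine (add_le_add l1 l2).trans ?_
  unfold dualValue
  have hu := sum_le_sum fun i (_ : i ∈ range n) => utility_inf_add_sup_le (m := m) (W := W) v w i
  rw [sum_add_distrib, sum_add_distrib] at hu
  have hc : ∑ c ∈ range (m + 1), (capacity m k (n + 1) (insert x T) c : ℝ) * (v ⊓ w) c +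
      ∑ c ∈ range (m + 1), (capacity m k (n + 1) S c : ℝ) * (v ⊔ w) c ≤
      ∑ c ∈ range (m + 1), (capacity m k (n + 1) T c : ℝ) * v c +
      ∑ c ∈ range (m + 1), (capacity m k (n + 1) (insert x S) c : ℝ) * w c := by
    rw [← sum_add_distrib, ← sum_add_distrib]
    refine sum_le_sum fun c _ => ?_
    have hadd : (v ⊓ w) c + (v ⊔ w) c = v c + w c := min_add_max _ _
    have hl : (v ⊓ w) c ≤ v c := inf_le_left
    have hr : (v ⊓ w) c ≤ w c := inf_le_right
    have hk : (0 : ℝ) ≤ k c := Nat.cast_nonneg _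
    by_cases hcm : c = m
    · simp only [capacity, if_pos hcm]
      rw [← mul_add, ← mul_add, hadd]
    · simp only [capacity, if_neg hcm, mem_insert]
      by_cases hcx : c = x
      · subst hcx
        have : c ∉ S := fun h' => hx (h h')
        simp only [hx, this, true_or, if_true, if_false]
        push_cast
        nlinarith
      · by_cases hcT : c ∈ T
        · by_cases hcS : c ∈ S
          · simp only [hcx, hcT, hcS, if_true, or_true]
            rw [← mul_add, ← mul_add, hadd]
          · simp only [hcx, hcT, hcS, if_true, or_true, or_false, if_false]
            push_cast
            nlinarith
        · have hcS : c ∉ S := fun h' => hcT (h h')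
          simp [hcx, hcT, hcS]
  linarith

theorem load_update (A : ℕ → ℕ) {j : ℕ} (hj : j < n) (c d : ℕ) :
    load n (Function.update A j c) d + (if d = A j then 1 else 0) =
      load n A d + (if d = c then 1 else 0) := by
  have key : ∀ B : ℕ → ℕ, load n B d =
      ((range n).erase j |>.filter (fun i => B i = d)).card + if d = B j then 1 else 0 := by
    intro B
    have : (range n).filter (fun i => B i = d) =
        (insert j ((range n).erase j)).filter (fun i => B i = d) := by
      rw [insert_erase (mem_range.2 hj)]
    rw [load, this, filter_insert]
    by_cases h : B j = d
    · rw [if_pos h, if_pos h.symm, card_insert_of_notMem (by simp)]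
    · rw [if_neg h, if_neg (Ne.symm h), add_zero]
  rw [key, key A]
  have : ((range n).erase j).filter (fun i => Function.update A j c i = d) =
      ((range n).erase j).filter (fun i => A i = d) := by
    refine filter_congr fun i hi => ?_
    rw [Function.update_of_ne (ne_of_mem_erase hi)]
  rw [this, Function.update_self]
  omega

theorem sum_range_capacity (r : ℕ) {S : Finset ℕ} (hS : S ⊆ range m) :
    ∑ c ∈ range m, capacity m k r S c = ∑ c ∈ S, k c := by
  rw [← sum_subset hS (f := fun c => capacity m k r S c)]
  · refine sum_congr rfl fun c hc => ?_
    have := mem_range.1 (hS hc)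
    simp [capacity, this.ne, hc]
  · intro c hc hcS
    have := mem_range.1 hc
    simp [capacity, this.ne, hcS]

/-- If there are enough students, the seminars of `S` can be filled up without loss. -/
theorem exists_fits_exact (hW : ∀ i c, 0 ≤ W i c) (hWm : ∀ i, W i m = 0) {S : Finset ℕ}
    (hS : S ⊆ range m) (hk : ∑ c ∈ S, k c ≤ n) (hA : Fits n m (capacity m k (n + 1) S) A) :
    ∃ B, Fits n m (capacity m k (n - ∑ c ∈ S, k c) S) B ∧ gain n W A ≤ gain n W B := by
  have hsum := sum_range_capacity (m := m) (k := k) (n + 1) hS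
  induction hl : load n A m using Nat.strong_induction_on generalizing A with
  | _ l ih =>
  have hload := sum_load hA.le
  rw [sum_range_succ] at hload
  by_cases hfull : ∀ c < m, load n A c = capacity m k (n + 1) S c
  · refine ⟨A, ⟨hA.le, fun c hc => ?_⟩, le_rfl⟩
    rcases hc.lt_or_eq with h | h
    · rw [hfull c h]
      simp [capacity, h.ne]
    · rw [sum_congr rfl fun c hc => hfull c (mem_range.1 hc), hsum] at hload
      subst h
      simp only [capacity, if_true]
      omega
  · push Not at hfull
    obtain ⟨c, hc, hne⟩ := hfull
    have hlt : load n A c < capacity m k (n + 1) S c := lt_of_le_of_ne (hA.load_le c hc.le) hne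
    have hlt' : ∑ c ∈ range m, load n A c < ∑ c ∈ S, k c := by
      rw [← hsum]
      exact sum_lt_sum (fun d hd => hA.load_le d (mem_range.1 hd).le) ⟨c, mem_range.2 hc, hlt⟩
    have hpos : 0 < load n A m := by omega
    obtain ⟨j, hj⟩ := card_pos.1 hpos
    obtain ⟨hj, hjm⟩ := mem_filter.1 hj
    have hj := mem_range.1 hj
    have hup := load_update A hj c
    rw [hjm] at hup
    have h1 := hup m
    rw [if_pos rfl, if_neg hc.ne'] at h1
    have hfit : Fits n m (capacity m k (n + 1) S) (Function.update A j c) := by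
      refine ⟨fun i hi => ?_, fun d hd => ?_⟩
      · by_cases hij : i = j
        · subst hij
          simpa using hc.le
        · rw [Function.update_of_ne hij]
          exact hA.le i hi
      · have h2 := hup d
        have h3 := hA.load_le d hd
        by_cases hdc : d = c
        · subst hdc
          rw [if_neg hc.ne, if_pos rfl] at h2
          omega
        · rw [if_neg hdc] at h2
          omega
    obtain ⟨B, hB, hg⟩ := ih _ (by omega) hfit rfl
    refine ⟨B, hB, le_trans (sum_le_sum fun i hi => ?_) hg⟩
    by_cases hij : i = j
    · subst hij
      rw [hjm, hWm]
      exact hW _ _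
    · rw [Function.update_of_ne hij]

/-- For seminars that can be held simultaneously, `value` is attained by assignments that fill
each of these seminars exactly. -/
theorem optimum_exact (hW : ∀ i c, 0 ≤ W i c) (hWm : ∀ i, W i m = 0) {S : Finset ℕ}
    (hS : S ⊆ range m) (hk : ∑ c ∈ S, k c ≤ n) :
    optimum n m W (capacity m k (n - ∑ c ∈ S, k c) S) = value n m W k S := by
  refine le_antisymm (optimum_le ?_ fun A hA => gain_le_optimum ⟨hA.le, fun c hc => ?_⟩)
    (optimum_le ⟨_, fits_const S⟩ fun A hA => ?_)
  · obtain ⟨B, hB, -⟩ := exists_fits_exact hW hWm hS hk (fits_const S)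
    exact ⟨B, hB⟩
  · refine (hA.load_le c hc).trans ?_
    unfold capacity
    split_ifs <;> omega
  · obtain ⟨B, hB, hg⟩ := exists_fits_exact hW hWm hS hk hA
    exact hg.trans (gain_le_optimum hB)

end Duality

/-! ### Submodular maximization under a budget -/

section Greedy

variable {f : Finset ℕ → ℝ} {k : ℕ → ℕ} {n : ℕ}

/-- `x` can be added to `S` within the budget `n`. -/
def Candidate (k : ℕ → ℕ) (n : ℕ) (S : Finset ℕ) (x : ℕ) : Prop :=
  x ∉ S ∧ 1 ≤ k x ∧ ∑ c ∈ S, k c + k x ≤ n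

/-- `x` is a candidate, and among the candidates the one of greatest marginal value per unit of
the budget. -/
def BestCandidate (f : Finset ℕ → ℝ) (m : ℕ) (k : ℕ → ℕ) (n : ℕ) (S : Finset ℕ) (x : ℕ) : Prop :=
  x < m ∧ Candidate k n S x ∧ ∀ y < m, Candidate k n S y →
    (f (insert y S) - f S) * k x ≤ (f (insert x S) - f S) * k y

/-- One step of the greedy algorithm: add the best candidate, if there is a candidate. -/
def GreedyStep (f : Finset ℕ → ℝ) (m : ℕ) (k : ℕ → ℕ) (n : ℕ) (S S' : Finset ℕ) : Prop :=
  (∃ x, BestCandidate f m k n S x ∧ S' = insert x S) ∨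
    ((∀ y < m, ¬ Candidate k n S y) ∧ S' = S)

variable (hsub : ∀ {S T : Finset ℕ}, S ⊆ T → ∀ {x : ℕ}, x ∉ T →
  f (insert x T) + f S ≤ f T + f (insert x S))

include hsub in
theorem sub_le_sum_marginal (S T : Finset ℕ) :
    f (S ∪ T) - f S ≤ ∑ x ∈ T \ S, (f (insert x S) - f S) := by
  induction T using Finset.induction_on with
  | empty => simp
  | insert y T hy ih =>
    by_cases hyS : y ∈ S
    · rw [insert_sdiff_of_mem _ hyS, union_insert, insert_eq_of_mem (mem_union_left _ hyS)]
      exact ih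
    · rw [insert_sdiff_of_notMem _ hyS, sum_insert (by simp [hy]), union_insert]
      have := hsub (S := S) (T := S ∪ T) subset_union_left (x := y) (by simp [hyS, hy])
      linarith


/-- The gap between `O` and `S` has become as small as in the analysis of the greedy algorithm
started from `Y`, where the budget `∑ c ∈ S, k c - ∑ c ∈ Y, k c` has been spent. -/
def GapBound (f : Finset ℕ → ℝ) (k : ℕ → ℕ) (n : ℕ) (O Y S : Finset ℕ) : Prop :=
  f O - f S ≤ Real.exp (-((∑ c ∈ S, (k c : ℝ) - ∑ c ∈ Y, (k c : ℝ)) / (n - ∑ c ∈ Y, (k c : ℝ)))) *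
    (f O - f Y)

variable (hmono : ∀ {S T : Finset ℕ}, S ⊆ T → f S ≤ f T) {O Y S : Finset ℕ}

include hsub hmono in
/-- Adding an element whose marginal value per unit of the budget is at least that of every missing
element of `O` keeps the gap as small as required. -/
theorem GapBound.insert (hO : ∑ c ∈ O, k c ≤ n) (hYO : Y ⊆ O) (hYS : Y ⊆ S)
    (hB : ∑ c ∈ Y, k c < n) {x : ℕ} (hx : x ∉ S)
    (hbest : ∀ o ∈ O \ S, (f (insert o S) - f S) * k x ≤ (f (insert x S) - f S) * k o)
    (h : GapBound f k n O Y S) : GapBound f k n O Y (insert x S) := by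
  unfold GapBound at *
  rw [sum_insert hx]
  have hB' : (0 : ℝ) < n - ∑ c ∈ Y, (k c : ℝ) := by
    rw [sub_pos]
    exact_mod_cast hB
  set B : ℝ := n - ∑ c ∈ Y, (k c : ℝ) with hBdef
  set D := f O - f S with hD
  set d := f (Insert.insert x S) - f S with hd
  have hd0 : 0 ≤ d := sub_nonneg.2 (hmono (subset_insert _ _))
  have hG : 0 ≤ f O - f Y := sub_nonneg.2 (hmono hYO)
  have hkx : (0 : ℝ) ≤ k x := Nat.cast_nonneg _
  have hcost : ∑ o ∈ O \ S, (k o : ℝ) ≤ B := by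
    have h1 : ∑ o ∈ O \ S, k o + ∑ o ∈ Y, k o ≤ n := by
      rw [← sum_union (disjoint_of_subset_right hYS sdiff_disjoint)]
      exact (sum_le_sum_of_subset (union_subset sdiff_subset hYO)).trans hO
    have h2 : ∑ o ∈ O \ S, (k o : ℝ) + ∑ o ∈ Y, (k o : ℝ) ≤ n := by exact_mod_cast h1
    linarith
  have hDd : D * k x ≤ d * B := by
    have h1 : D ≤ ∑ o ∈ O \ S, (f (Insert.insert o S) - f S) :=
      (sub_le_sub_right (hmono subset_union_right) _).trans (sub_le_sum_marginal hsub S O)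
    calc D * k x ≤ (∑ o ∈ O \ S, (f (Insert.insert o S) - f S)) * k x :=
          mul_le_mul_of_nonneg_right h1 hkx
      _ = ∑ o ∈ O \ S, (f (Insert.insert o S) - f S) * k x := sum_mul _ _ _
      _ ≤ ∑ o ∈ O \ S, d * k o := sum_le_sum hbest
      _ = d * ∑ o ∈ O \ S, (k o : ℝ) := (mul_sum _ _ _).symm
      _ ≤ d * B := mul_le_mul_of_nonneg_left hcost hd0
  have hnew : f O - f (Insert.insert x S) = D - d := by rw [hD, hd]; ring
  rw [hnew]
  rcases le_total D 0 with hneg | hpos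
  · exact le_trans (by linarith) (mul_nonneg (Real.exp_pos _).le hG)
  · have h1 : D - d ≤ D * (1 - k x / B) := by
      have : D * k x / B ≤ d := by rwa [div_le_iff₀ hB']
      have h2 : D * (1 - k x / B) = D - D * k x / B := by ring
      linarith
    have h2 : 1 - k x / B ≤ Real.exp (-(k x / B)) := by
      have := Real.add_one_le_exp (-(k x / B))
      linarith
    refine (h1.trans (mul_le_mul_of_nonneg_left h2 hpos)).trans ?_
    refine (mul_le_mul_of_nonneg_right h (Real.exp_pos _).le).trans (le_of_eq ?_)
    rw [mul_right_comm, ← Real.exp_add]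
    congr 2
    ring

variable {m : ℕ}

/-- What the greedy algorithm maintains when it is started from `Y` and compared with `O`. -/
structure GreedyInvariant (f : Finset ℕ → ℝ) (m : ℕ) (k : ℕ → ℕ) (n : ℕ) (O Y S : Finset ℕ) :
    Prop where
  subset : Y ⊆ S
  close : (1 - Real.exp (-1)) * f O ≤ f S ∨ GapBound f k n O Y S

theorem GreedyInvariant.refl : GreedyInvariant f m k n O Y Y :=
  ⟨Subset.rfl, Or.inr (by simp [GapBound])⟩

/-- The premises of the analysis: `O` is a set within the budget, and no element of it is worth
more than a third of `f Y` on top of a set that contains `Y`. -/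
structure GreedyStart (f : Finset ℕ → ℝ) (m : ℕ) (k : ℕ → ℕ) (n : ℕ) (O Y : Finset ℕ) : Prop where
  subset_range : O ⊆ range m
  one_le : ∀ c ∈ O, 1 ≤ k c
  cost_le : ∑ c ∈ O, k c ≤ n
  subset : Y ⊆ O
  marginal_le : ∀ T, Y ⊆ T → ∀ o ∈ O, o ∉ T → 3 * (f (insert o T) - f T) ≤ f Y

include hsub hmono in
/-- Either the guarantee is reached, or the missing element of `O` of greatest marginal value per
unit of the budget still fits, and then a best candidate is at least as good. -/
theorem GreedyStart.dichotomy (hf : ∀ S, 0 ≤ f S) (h : GreedyStart f m k n O Y)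
    (hS : GreedyInvariant f m k n O Y S) :
    (1 - Real.exp (-1)) * f O ≤ f S ∨
      (∃ o < m, Candidate k n S o) ∧ ∀ x, BestCandidate f m k n S x →
        GapBound f k n O Y (insert x S) := by
  rcases hS.close with hdone | hgap
  · exact Or.inl hdone
  have he : (0 : ℝ) < Real.exp (-1) := Real.exp_pos _
  by_cases hOS : O ⊆ S
  · left
    nlinarith [hmono hOS, hf O]
  obtain ⟨o, ho, hmax⟩ := exists_max_image (O \ S) (fun o => (f (insert o S) - f S) / k o)
    (sdiff_nonempty.2 hOS)
  have hkpos : ∀ o ∈ O \ S, (0 : ℝ) < k o := fun o ho => by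
    exact_mod_cast h.one_le o (mem_sdiff.1 ho).1
  have hmax' : ∀ y ∈ O \ S, (f (insert y S) - f S) * k o ≤ (f (insert o S) - f S) * k y :=
    fun y hy => (div_le_div_iff₀ (hkpos y hy) (hkpos o ho)).1 (hmax y hy)
  obtain ⟨hoO, hoS⟩ := mem_sdiff.1 ho
  have hB : ∑ c ∈ Y, k c < n := by
    have h1 : k o + ∑ c ∈ Y, k c ≤ n := by
      rw [← sum_insert fun hY => hoS (hS.subset hY)]
      exact (sum_le_sum_of_subset (insert_subset hoO h.subset)).trans h.cost_le
    have := h.one_le o hoO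
    omega
  by_cases hfit : ∑ c ∈ S, k c + k o ≤ n
  · right
    have hcand : Candidate k n S o := ⟨hoS, h.one_le o hoO, hfit⟩
    have hom : o < m := mem_range.1 (h.subset_range hoO)
    refine ⟨⟨o, hom, hcand⟩, fun x hx => ?_⟩
    refine hgap.insert hsub hmono h.cost_le h.subset hS.subset hB hx.2.1.1 fun y hy => ?_
    have h1 := hmax' y hy
    have h2 := hx.2.2 o hom hcand
    have hko := hkpos o ho
    have hky := hkpos y hy
    have hkx : (0 : ℝ) ≤ k x := Nat.cast_nonneg _
    refine le_of_mul_le_mul_right ?_ hko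
    calc (f (insert y S) - f S) * k x * k o = (f (insert y S) - f S) * k o * k x := by ring
      _ ≤ (f (insert o S) - f S) * k y * k x := mul_le_mul_of_nonneg_right h1 hkx
      _ = (f (insert o S) - f S) * k x * k y := by ring
      _ ≤ (f (insert x S) - f S) * k o * k y := mul_le_mul_of_nonneg_right h2 hky.le
      _ = (f (insert x S) - f S) * k y * k o := by ring
  · left
    have h1 := hgap.insert hsub hmono h.cost_le h.subset hS.subset hB hoS hmax'
    have h2 := h.marginal_le S hS.subset o hoO hoS
    unfold GapBound at h1
    have hB' : (0 : ℝ) < n - ∑ c ∈ Y, (k c : ℝ) := by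
      rw [sub_pos]
      exact_mod_cast hB
    have h3 : Real.exp (-((∑ c ∈ insert o S, (k c : ℝ) - ∑ c ∈ Y, (k c : ℝ)) /
        (n - ∑ c ∈ Y, (k c : ℝ)))) ≤ Real.exp (-1) := by
      rw [Real.exp_le_exp, neg_le_neg_iff, one_le_div hB', sum_insert hoS]
      have : (n : ℝ) ≤ ∑ c ∈ S, (k c : ℝ) + k o := by exact_mod_cast (not_le.1 hfit).le
      linarith
    have h4 : f O - f (insert o S) ≤ Real.exp (-1) * (f O - f Y) :=
      h1.trans (mul_le_mul_of_nonneg_right h3 (sub_nonneg.2 (hmono h.subset)))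
    -- the loss of `f Y / 3` is paid by `exp (-1) * f Y`, since `exp 1 < 3`
    have h5 : (1 : ℝ) / 3 ≤ Real.exp (-1) := by
      rw [Real.exp_neg, one_div]
      exact inv_anti₀ (Real.exp_pos _) (by linarith [Real.exp_one_lt_d9])
    nlinarith [hf Y]

include hsub hmono in
theorem GreedyInvariant.step (hf : ∀ S, 0 ≤ f S) (h : GreedyStart f m k n O Y)
    (hS : GreedyInvariant f m k n O Y S) {S' : Finset ℕ} (hstep : GreedyStep f m k n S S') :
    GreedyInvariant f m k n O Y S' := by
  rcases hstep with ⟨x, hx, rfl⟩ | ⟨-, rfl⟩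
  · refine ⟨hS.subset.trans (subset_insert _ _), ?_⟩
    rcases h.dichotomy hsub hmono hf hS with hdone | ⟨-, hgap⟩
    · exact Or.inl (hdone.trans (hmono (subset_insert _ _)))
    · exact Or.inr (hgap x hx)
  · exact hS

include hsub hmono in
theorem GreedyInvariant.steps (hf : ∀ S, 0 ≤ f S) (h : GreedyStart f m k n O Y)
    (hS : Relation.ReflTransGen (GreedyStep f m k n) Y S) : GreedyInvariant f m k n O Y S := by
  induction hS with
  | refl => exact .refl
  | tail _ hstep ih => exact ih.step hsub hmono hf h hstep

include hsub hmono in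
theorem GreedyInvariant.guarantee (hf : ∀ S, 0 ≤ f S) (h : GreedyStart f m k n O Y)
    (hS : GreedyInvariant f m k n O Y S) (hend : ∀ y < m, ¬ Candidate k n S y) :
    (1 - Real.exp (-1)) * f O ≤ f S := by
  rcases h.dichotomy hsub hmono hf hS with hdone | ⟨⟨o, ho, hcand⟩, -⟩
  · exact hdone
  · exact absurd hcand (hend o ho)

open Classical in
/-- Add `x` to `S` if it is a candidate. -/
noncomputable def extend (k : ℕ → ℕ) (n : ℕ) (S : Finset ℕ) (x : ℕ) : Finset ℕ :=
  if Candidate k n S x then insert x S else S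

include hmono in
theorem exists_extend (hkm : k m = 0) (hO : O ⊆ range m) (hk : ∀ c ∈ O, 1 ≤ k c)
    (hcost : ∑ c ∈ O, k c ≤ n) {Z : Finset ℕ} (hZ : Z ⊆ O) :
    ∃ y ≤ m, Z ⊆ extend k n Z y ∧ extend k n Z y ⊆ O ∧
      ∀ o ∈ O, f (insert o Z) ≤ f (extend k n Z y) := by
  by_cases hOZ : O ⊆ Z
  · have : extend k n Z m = Z := if_neg fun h => by simpa [hkm] using h.2.1
    refine ⟨m, le_rfl, ?_⟩
    rw [this]
    exact ⟨Subset.rfl, hZ, fun o ho => by rw [insert_eq_of_mem (hOZ ho)]⟩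
  · obtain ⟨y, hy, hmax⟩ := exists_max_image (O \ Z) (fun o => f (insert o Z))
      (sdiff_nonempty.2 hOZ)
    obtain ⟨hyO, hyZ⟩ := mem_sdiff.1 hy
    have hsub : insert y Z ⊆ O := insert_subset hyO hZ
    have : extend k n Z y = insert y Z := by
      refine if_pos ⟨hyZ, hk y hyO, ?_⟩
      rw [add_comm, ← sum_insert hyZ]
      exact (sum_le_sum_of_subset hsub).trans hcost
    refine ⟨y, (mem_range.1 (hO hyO)).le, ?_⟩
    rw [this]
    refine ⟨subset_insert _ _, hsub, fun o ho => ?_⟩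
    by_cases hoZ : o ∈ Z
    · rw [insert_eq_of_mem hoZ]
      exact hmono (subset_insert _ _)
    · exact hmax o (mem_sdiff.2 ⟨ho, hoZ⟩)

include hsub hmono in
/-- The three elements of `O` chosen one after the other for their marginal values make a good
start for the greedy algorithm. -/
theorem exists_greedyStart (hf : ∀ S, 0 ≤ f S) (hkm : k m = 0) (hO : O ⊆ range m)
    (hk : ∀ c ∈ O, 1 ≤ k c) (hcost : ∑ c ∈ O, k c ≤ n) :
    ∃ x ≤ m, ∃ y ≤ m, ∃ z ≤ m,
      GreedyStart f m k n O (extend k n (extend k n (extend k n ∅ x) y) z) := by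
  obtain ⟨x, hx, hx1, hx2, hx3⟩ := exists_extend hmono hkm hO hk hcost (empty_subset O)
  obtain ⟨y, hy, hy1, hy2, hy3⟩ := exists_extend hmono hkm hO hk hcost hx2
  obtain ⟨z, hz, hz1, hz2, hz3⟩ := exists_extend hmono hkm hO hk hcost hy2
  refine ⟨x, hx, y, hy, z, hz, hO, hk, hcost, hz2, fun T hT o ho hoT => ?_⟩
  have h1 := hsub (empty_subset T) hoT
  have h2 := hsub ((hy1.trans hz1).trans hT) hoT
  have h3 := hsub (hz1.trans hT) hoT
  linarith [hx3 o ho, hy3 o ho, hz3 o ho, hf ∅]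

end Greedy

/-! ### Alternating trees -/

section Tree

variable {n m : ℕ} {W : ℕ → ℕ → ℝ} {cap A : ℕ → ℕ} {v : ℕ → ℝ} {src tip : ℕ} {T : Finset ℕ}
  {par rank : ℕ → ℕ}

/-- The alternating tree `T` grown from the overfull option `src`. The student `par c` is indifferent
between `c` and the option `A (par c)` to which `A` sends him and which joined the tree before `c`.
The option `tip` joined last; it is the only one that may have a free place. The function `rank` is
the time of joining. -/
structure Tree (n m : ℕ) (W : ℕ → ℕ → ℝ) (cap A : ℕ → ℕ) (v : ℕ → ℝ) (src : ℕ) (T : Finset ℕ)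
    (par rank : ℕ → ℕ) (tip : ℕ) : Prop where
  le : ∀ c ∈ T, c ≤ m
  src_mem : src ∈ T
  tip_mem : tip ∈ T
  full : ∀ c ∈ T, c ≠ tip → cap c ≤ load n A c
  rank_lt : ∀ c ∈ T, rank c < T.card
  parent : ∀ c ∈ T, c ≠ src → par c < n ∧ A (par c) ∈ T ∧ rank (A (par c)) < rank c ∧
    W (par c) c - v c = W (par c) (A (par c)) - v (A (par c))

theorem Tree.single (hsrc : src ≤ m) (par : ℕ → ℕ) :
    Tree n m W cap A v src {src} par (fun _ => 0) src where
  le c hc := by rwa [mem_singleton.1 hc]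
  src_mem := mem_singleton_self _
  tip_mem := mem_singleton_self _
  full c hc h := absurd (mem_singleton.1 hc) h
  rank_lt c _ := by simp
  parent c hc h := absurd (mem_singleton.1 hc) h

/-- How much more net value student `j` has from the option to which `A` sends him than from `c`. -/
def regret (W : ℕ → ℕ → ℝ) (A : ℕ → ℕ) (v : ℕ → ℝ) (j c : ℕ) : ℝ :=
  W j (A j) - v (A j) - W j c + v c

/-- Student `j` is in the tree and the option `c` is not. -/
def Leaving (n m : ℕ) (A : ℕ → ℕ) (T : Finset ℕ) (j c : ℕ) : Prop :=
  j < n ∧ c ≤ m ∧ A j ∈ T ∧ c ∉ T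

/-- If the tip is full, some student in the tree can leave it: otherwise all options would be full,
and one of them overfull. -/
theorem Tree.exists_leaving (ht : Tree n m W cap A v src T par rank tip) (hA : ∀ i < n, A i ≤ m)
    (hcap : n ≤ ∑ c ∈ range (m + 1), cap c) (hsrc : cap src < load n A src)
    (htip : cap tip ≤ load n A tip) : ∃ j c, Leaving n m A T j c := by
  have hpos : 0 < load n A src := by omega
  obtain ⟨j, hj⟩ := card_pos.1 hpos
  obtain ⟨hj, hjs⟩ := mem_filter.1 hj
  by_contra! hno
  have hall : ∀ c ∈ range (m + 1), c ∈ T := fun c hc => by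
    by_contra hcT
    exact hno j c ⟨mem_range.1 hj, Nat.lt_succ_iff.1 (mem_range.1 hc), hjs ▸ ht.src_mem, hcT⟩
  have hfull : ∀ c ∈ range (m + 1), cap c ≤ load n A c := fun c hc => by
    by_cases h : c = tip
    · rwa [h]
    · exact ht.full c (hall c hc) h
  have := sum_lt_sum hfull ⟨src, mem_range.2 (Nat.lt_succ_iff.2 (ht.le _ ht.src_mem)), hsrc⟩
  rw [sum_load hA] at this
  omega

/-- The tree grows by one option after its prices have been raised by the least regret. -/
theorem Tree.grow (ht : Tree n m W cap A v src T par rank tip) (hS : Supported n m W cap A v)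
    (htip : cap tip ≤ load n A tip) {j c : ℕ} (hjc : Leaving n m A T j c)
    (hmin : ∀ j' c', Leaving n m A T j' c' → regret W A v j c ≤ regret W A v j' c') :
    Supported n m W cap A (fun d => if d ∈ T then v d + regret W A v j c else v d) ∧
      Tree n m W cap A (fun d => if d ∈ T then v d + regret W A v j c else v d) src (insert c T)
        (Function.update par c j) (Function.update rank c T.card) c := by
  obtain ⟨hj, hc, hjT, hcT⟩ := hjc
  set δ := regret W A v j c with hδ
  have hδ0 : 0 ≤ δ := by
    have := hS.best j hj c hc
    rw [hδ, regret]
    linarith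
  refine ⟨⟨hS.le, fun i hi d hd => ?_, fun d hd => ?_, fun d hd hlt => ?_⟩, ?_, ?_, ?_, ?_, ?_, ?_⟩
  · have h1 := hS.best i hi d hd
    by_cases hiT : A i ∈ T <;> by_cases hdT : d ∈ T <;> simp only [hiT, hdT, if_true, if_false]
    · linarith
    · have := hmin i d ⟨hi, hd, hiT, hdT⟩
      simp only [regret] at this
      linarith
    · linarith
    · linarith
  · have := hS.nonneg d hd
    split_ifs <;> linarith
  · by_cases hdT : d ∈ T
    · by_cases hd' : d = tip
      · subst hd'
        omega
      · have := ht.full d hdT hd'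
        omega
    · simpa [hdT] using hS.price_eq_zero d hd hlt
  · intro d hd
    rcases mem_insert.1 hd with rfl | hd
    · exact hc
    · exact ht.le d hd
  · exact mem_insert_of_mem ht.src_mem
  · exact mem_insert_self _ _
  · intro d hd hdc
    have hdT := (mem_insert.1 hd).resolve_left hdc
    by_cases h : d = tip
    · rwa [h]
    · exact ht.full d hdT h
  · intro d hd
    rw [card_insert_of_notMem hcT]
    by_cases hdc : d = c
    · subst hdc
      simp
    · rw [Function.update_of_ne hdc]
      exact (ht.rank_lt d ((mem_insert.1 hd).resolve_left hdc)).trans (Nat.lt_succ_self _)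
  · intro d hd hds
    by_cases hdc : d = c
    · subst hdc
      have hne : A j ≠ d := fun h => hcT (h ▸ hjT)
      simp only [Function.update_self, hjT, hcT, if_true, if_false, Function.update_of_ne hne]
      refine ⟨hj, mem_insert_of_mem hjT, ht.rank_lt _ hjT, ?_⟩
      rw [hδ, regret]
      ring
    · have hdT := (mem_insert.1 hd).resolve_left hdc
      obtain ⟨h1, h2, h3, h4⟩ := ht.parent d hdT hds
      have hne : A (par d) ≠ c := fun h => hcT (h ▸ h2)
      simp only [Function.update_of_ne hdc, Function.update_of_ne hne, h2, hdT, if_true]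
      exact ⟨h1, mem_insert_of_mem h2, h3, by linarith⟩

/-- The state while students are shifted along the path from the tip to the source of a tree.
The map `A₀` is the one with which the shifting started; compared with it, `A` sends one student more
to `tip` and one less to `cur`. The part of the path between `src` and `cur` is still intact. -/
structure Shifting (n m : ℕ) (W : ℕ → ℕ → ℝ) (A₀ A : ℕ → ℕ) (v : ℕ → ℝ) (src tip : ℕ)
    (T : Finset ℕ) (par rank : ℕ → ℕ) (cur : ℕ) : Prop where
  le : ∀ i < n, A i ≤ m
  best : ∀ i < n, ∀ c ≤ m, W i c - v c ≤ W i (A i) - v (A i)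
  mem : cur ∈ T
  load_add : ∀ c, load n A c + (if c = cur then 1 else 0) =
    load n A₀ c + (if c = tip then 1 else 0)
  parent : ∀ c ∈ T, c ≠ src → rank c ≤ rank cur → par c < n ∧ A (par c) ∈ T ∧
    rank (A (par c)) < rank c ∧ W (par c) c - v c = W (par c) (A (par c)) - v (A (par c))

theorem Tree.shifting (ht : Tree n m W cap A v src T par rank tip)
    (hS : Supported n m W cap A v) : Shifting n m W A A v src tip T par rank tip :=
  ⟨hS.le, hS.best, ht.tip_mem, fun _ => rfl, fun c hc h _ => ht.parent c hc h⟩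

theorem Shifting.shift {A₀ : ℕ → ℕ} {cur : ℕ} (hT : ∀ c ∈ T, c ≤ m)
    (h : Shifting n m W A₀ A v src tip T par rank cur) (hcur : cur ≠ src) :
    Shifting n m W A₀ (Function.update A (par cur) cur) v src tip T par rank (A (par cur)) ∧
      rank (A (par cur)) < rank cur := by
  obtain ⟨h1, h2, h3, h4⟩ := h.parent cur h.mem hcur le_rfl
  refine ⟨⟨fun i hi => ?_, fun i hi c hc => ?_, h2, fun c => ?_, fun c hc hcs hr => ?_⟩, h3⟩
  · by_cases hij : i = par cur
    · rw [hij, Function.update_self]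
      exact hT _ h.mem
    · rw [Function.update_of_ne hij]
      exact h.le i hi
  · by_cases hij : i = par cur
    · subst hij
      rw [Function.update_self, h4]
      exact h.best _ hi c hc
    · rw [Function.update_of_ne hij]
      exact h.best i hi c hc
  · rw [load_update A h1 cur c]
    exact h.load_add c
  · obtain ⟨g1, g2, g3, g4⟩ := h.parent c hc hcs (hr.trans h3.le)
    -- the student shifted away sits behind `c` on the path
    have hne : par c ≠ par cur := fun he => by
      rw [he] at g3
      omega
    rw [Function.update_of_ne hne]
    exact ⟨g1, g2, g3, g4⟩

/-- The number of students in excess of the capacities. -/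
def excess (n m : ℕ) (cap A : ℕ → ℕ) : ℕ := ∑ c ∈ range (m + 1), (load n A c - cap c)

theorem excess_le (hA : ∀ i < n, A i ≤ m) : excess n m cap A ≤ n :=
  (sum_le_sum fun _ _ => Nat.sub_le _ _).trans (sum_load hA).le

/-- When the path to the source has been shifted, the prices still support the assignment, and the
excess is smaller. -/
theorem Shifting.finish {A₀ : ℕ → ℕ} (h : Shifting n m W A₀ A v src tip T par rank src)
    (hS : Supported n m W cap A₀ v) (hT : ∀ c ∈ T, c ≤ m) (hsrc : cap src < load n A₀ src)
    (htip : load n A₀ tip < cap tip) :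
    Supported n m W cap A v ∧ excess n m cap A < excess n m cap A₀ := by
  have hne : src ≠ tip := fun he => by subst he; omega
  refine ⟨⟨h.le, h.best, hS.nonneg, fun c hc hlt => hS.price_eq_zero c hc ?_⟩, ?_⟩
  · have := h.load_add c
    by_cases h1 : c = src
    · subst h1
      rw [if_pos rfl, if_neg hne] at this
      omega
    · rw [if_neg h1] at this
      omega
  · refine sum_lt_sum (fun c _ => ?_) ⟨src, mem_range.2 (Nat.lt_succ_iff.2 (hT _ h.mem)), ?_⟩
    · have := h.load_add c
      by_cases h1 : c = tip
      · subst h1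
        rw [if_neg hne.symm, if_pos rfl] at this
        omega
      · rw [if_neg h1] at this
        omega
    · have := h.load_add src
      rw [if_pos rfl, if_neg hne] at this
      omega

theorem Supported.fits (hS : Supported n m W cap A v) (h : ∀ c ≤ m, load n A c ≤ cap c) :
    Fits n m cap A := ⟨hS.le, h⟩

theorem load_le_of_excess_eq_zero (h : excess n m cap A = 0) : ∀ c ≤ m, load n A c ≤ cap c := by
  intro c hc
  have := sum_eq_zero_iff.1 h c (mem_range.2 (Nat.lt_succ_iff.2 hc))
  omega

end Tree

/-! ### Columns of the memory -/

/-- The first column of an array of natural numbers; the entry `0` of it is used as a register. -/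
def col (s : Store) (a i : ℕ) : ℕ := s.nat a i 0

/-- The first column of an array of real numbers. -/
def rcol (s : Store) (a i : ℕ) : ℝ := s.real a i 0

@[simp] theorem col_writeNat_self (s : Store) (a i v : ℕ) :
    col (s.writeNat a i 0 v) a = Function.update (col s a) i v := by
  funext i'
  by_cases h : i' = i <;> simp [col, h]

@[simp] theorem col_writeNat_of_ne (s : Store) {a b : ℕ} (h : b ≠ a) (i v : ℕ) :
    col (s.writeNat a i 0 v) b = col s b := by
  funext i'
  simp [col, h]

@[simp] theorem col_writeReal (s : Store) (a i j : ℕ) (v : ℝ) :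
    col (s.writeReal a i j v) = col s := rfl

@[simp] theorem rcol_writeReal_self (s : Store) (a i : ℕ) (v : ℝ) :
    rcol (s.writeReal a i 0 v) a = Function.update (rcol s a) i v := by
  funext i'
  by_cases h : i' = i <;> simp [rcol, h]

@[simp] theorem rcol_writeReal_of_ne (s : Store) {a b : ℕ} (h : b ≠ a) (i : ℕ) (v : ℝ) :
    rcol (s.writeReal a i 0 v) b = rcol s b := by
  funext i'
  simp [rcol, h]

@[simp] theorem real_writeReal_of_ne (s : Store) {a b : ℕ} (h : b ≠ a) (i j : ℕ) (v : ℝ) :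
    (s.writeReal a i j v).real b = s.real b := by
  funext i' j'
  simp [h]

@[simp] theorem rcol_writeNat (s : Store) (a i j v : ℕ) :
    rcol (s.writeNat a i j v) = rcol s := rfl

/-- The register `a`. -/
def reg (a : ℕ) : NatExpr := .get a (.const 0) (.const 0)

/-- The entry `i` of the first column of the array `a`. -/
def entry (a : ℕ) (i : NatExpr) : NatExpr := .get a i (.const 0)

/-- The real register `a`. -/
def rreg (a : ℕ) : RealExpr := .get a (.const 0) (.const 0)

/-- The entry `i` of the first column of the array `a` of real numbers. -/
def rentry (a : ℕ) (i : NatExpr) : RealExpr := .get a i (.const 0)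

@[simp] theorem eval_reg (s : Store) (a : ℕ) : (reg a).eval s = col s a 0 := rfl
@[simp] theorem eval_entry (s : Store) (a : ℕ) (i : NatExpr) :
    (entry a i).eval s = col s a (i.eval s) := rfl
@[simp] theorem eval_rreg (s : Store) (a : ℕ) : (rreg a).eval s = rcol s a 0 := rfl
@[simp] theorem eval_rentry (s : Store) (a : ℕ) (i : NatExpr) :
    (rentry a i).eval s = rcol s a (i.eval s) := rfl

namespace ForProg

/-- Store a number in the register `a`. -/
def setReg (a : ℕ) (v : NatExpr) : ForProg := .setNat a (.const 0) (.const 0) v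

/-- Store a number in the first column of the array `a`. -/
def setEntry (a : ℕ) (i v : NatExpr) : ForProg := .setNat a i (.const 0) v

/-- Store a real number in the register `a`. -/
def setRReg (a : ℕ) (v : RealExpr) : ForProg := .setReal a (.const 0) (.const 0) v

/-- Store a real number in the first column of the array `a`. -/
def setREntry (a : ℕ) (i : NatExpr) (v : RealExpr) : ForProg := .setReal a i (.const 0) v

/-- Execute the programs of a list one after the other. -/
def block : List ForProg → ForProg
  | [] => .skip
  | [c] => c
  | c :: d :: l => .seq c (block (d :: l))

@[simp] theorem run_setReg (a : ℕ) (v : NatExpr) (s : Store) :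
    (setReg a v).run s = s.writeNat a 0 0 (v.eval s) := rfl
@[simp] theorem run_setEntry (a : ℕ) (i v : NatExpr) (s : Store) :
    (setEntry a i v).run s = s.writeNat a (i.eval s) 0 (v.eval s) := rfl
@[simp] theorem run_setRReg (a : ℕ) (v : RealExpr) (s : Store) :
    (setRReg a v).run s = s.writeReal a 0 0 (v.eval s) := rfl
@[simp] theorem run_setREntry (a : ℕ) (i : NatExpr) (v : RealExpr) (s : Store) :
    (setREntry a i v).run s = s.writeReal a (i.eval s) 0 (v.eval s) := rfl
@[simp] theorem run_skip (s : Store) : skip.run s = s := rfl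
@[simp] theorem run_seq (c d : ForProg) (s : Store) : (seq c d).run s = d.run (c.run s) := rfl
open Classical in
@[simp] theorem run_branch (t : Test) (c d : ForProg) (s : Store) :
    (branch t c d).run s = if t.Holds s then c.run s else d.run s := rfl
@[simp] theorem run_block_nil (s : Store) : (block []).run s = s := rfl
@[simp] theorem run_block_singleton (c : ForProg) (s : Store) : (block [c]).run s = c.run s := rfl
@[simp] theorem run_block_cons (c d : ForProg) (l : List ForProg) (s : Store) :
    (block (c :: d :: l)).run s = (block (d :: l)).run (c.run s) := rfl

theorem col_run (c : ForProg) (s : Store) {a : ℕ} (ha : a ∉ c.natWrites) :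
    col (c.run s) a = col s a := by
  funext i
  rw [col, nat_run_of_notMem c ha, col]

theorem rcol_run (c : ForProg) (s : Store) {a : ℕ} (ha : a ∉ c.realWrites) :
    rcol (c.run s) a = rcol s a := by
  funext i
  rw [rcol, real_run_of_notMem c ha, rcol]

/-- Induction over the iterations of a loop, for an invariant that does not depend on the counter of
the loop. -/
theorem run_loop_spec {x : ℕ} {r : Range} {c : ForProg} (hwf : (loop x r c).wellFormed)
    (s : Store) {N : ℕ} (hN : r.bound.eval s = N) (I : ℕ → Store → Prop)
    (hI : ∀ j s' v, I j s' → I j (s'.writeNat x 0 0 v)) (h0 : I 0 s)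
    (hstep : ∀ j < N, ∀ s' : Store, I j s' → col s' x 0 = j →
      (∀ a ∉ (loop x r c).natWrites, col s' a = col s a) →
      (∀ a ∉ (loop x r c).realWrites, s'.real a = s.real a) → I (j + 1) (c.run s')) :
    I N ((loop x r c).run s) := by
  rw [← hN]
  refine run_loop_induct hwf s I (hI _ _ _ h0) fun j hj s' h hx hn hr => hI _ _ _ ?_
  exact hstep j (hN ▸ hj) s' h hx (fun a ha => by funext i; rw [col, hn a ha, col]) hr

end ForProg

/-! ### The program for optimal assignments -/

/-! Names of arrays and registers. The arrays of natural numbers `cap`, `asg`, `cnt` hold the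
capacities, the assignment and the numbers of students at the options; `tree` and `par` hold an
alternating tree from `src` to `tip`; the registers `stu` and `opt` hold a student and an option.
The arrays and registers of real numbers are numbered separately, from `profit` on. The names `0`
and `1` of the numbers of students and seminars are
fixed by the input, and so are the names of the arrays `elem`, `out` and `profit`. -/

namespace Arr
abbrev students : ℕ := 0
abbrev seminars : ℕ := 1
abbrev elem : ℕ := 2
abbrev out : ℕ := 4
abbrev cap : ℕ := 5
abbrev asg : ℕ := 6
abbrev cnt : ℕ := 7
abbrev tree : ℕ := 8
abbrev par : ℕ := 9
abbrev src : ℕ := 10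
abbrev tip : ℕ := 11
abbrev found : ℕ := 12
abbrev stu : ℕ := 13
abbrev opt : ℕ := 14
abbrev old : ℕ := 15
abbrev loopRound : ℕ := 20
abbrev loopOpt : ℕ := 21
abbrev loopPath : ℕ := 22
abbrev loopStu : ℕ := 23
abbrev profit : ℕ := 0
abbrev price : ℕ := 1
abbrev raise : ℕ := 2
abbrev val : ℕ := 3
end Arr

open ForProg

@[simp] theorem eval_bound_students (s : Store) :
    Range.students.bound.eval s = col s Arr.students 0 := rfl
@[simp] theorem eval_bound_seminars (s : Store) :
    Range.seminars.bound.eval s = col s Arr.seminars 0 + 1 := rfl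

/-- The profit of sending student `i` to option `c`. It is `0` for the option `m`, since the input
has `0` in this place. -/
def profitExpr (i c : NatExpr) : RealExpr := .get Arr.profit i c

@[simp] theorem eval_profitExpr (s : Store) (i c : NatExpr) :
    (profitExpr i c).eval s = s.real Arr.profit (i.eval s) (c.eval s) := rfl

/-- Send every student to an option of greatest profit, at prices `0`. -/
def initMatching : ForProg := block [
  loop Arr.loopOpt .seminars (block [
    setREntry Arr.price (reg Arr.loopOpt) .zero,
    setEntry Arr.cnt (reg Arr.loopOpt) (.const 0)]),
  loop Arr.loopStu .students (block [
    setEntry Arr.asg (reg Arr.loopStu) (.const 0),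
    loop Arr.loopOpt .seminars (branch
      (.realLe (profitExpr (reg Arr.loopStu) (entry Arr.asg (reg Arr.loopStu)))
        (profitExpr (reg Arr.loopStu) (reg Arr.loopOpt)))
      (setEntry Arr.asg (reg Arr.loopStu) (reg Arr.loopOpt))
      skip),
    setEntry Arr.cnt (entry Arr.asg (reg Arr.loopStu))
      (.plus (entry Arr.cnt (entry Arr.asg (reg Arr.loopStu))) (.const 1))])]

/-- The memory holds an assignment that is supported by the prices, and the numbers of students
assigned to the options. -/
structure Matching (n m : ℕ) (s : Store) : Prop where
  supported : Supported n m (s.real Arr.profit) (col s Arr.cap) (col s Arr.asg) (rcol s Arr.price)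
  cnt : ∀ c ≤ m, col s Arr.cnt c = load n (col s Arr.asg) c

theorem load_succ (n : ℕ) (A : ℕ → ℕ) (c : ℕ) :
    load (n + 1) A c = load n A c + if c = A n then 1 else 0 := by
  rw [load, range_add_one, filter_insert]
  by_cases h : A n = c
  · rw [if_pos h, if_pos h.symm, card_insert_of_notMem (by simp), load]
  · rw [if_neg h, if_neg (Ne.symm h), load, add_zero]

theorem load_congr {n : ℕ} {A B : ℕ → ℕ} (h : ∀ i < n, A i = B i) (c : ℕ) :
    load n A c = load n B c := by
  unfold load
  congr 1
  exact filter_congr fun i hi => by rw [h i (mem_range.1 hi)]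

theorem matching_initMatching {n m : ℕ} (s : Store) (hn : col s Arr.students 0 = n)
    (hm : col s Arr.seminars 0 = m) : Matching n m (initMatching.run s) := by
  simp only [initMatching, run_block_cons, run_block_singleton]
  set s₁ := ForProg.run (loop Arr.loopOpt .seminars (block [
    setREntry Arr.price (reg Arr.loopOpt) .zero,
    setEntry Arr.cnt (reg Arr.loopOpt) (.const 0)])) s with hs₁
  have h1 : ∀ c < m + 1, rcol s₁ Arr.price c = 0 ∧ col s₁ Arr.cnt c = 0 := by
    refine run_loop_spec rfl s (N := m + 1) (by simp [hm])
      (fun j s' => ∀ c < j, rcol s' Arr.price c = 0 ∧ col s' Arr.cnt c = 0)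
      (fun j s' v h => by simpa using h) (fun c hc => by omega) ?_
    intro j hj s' h hx hfn hfr c hc
    rcases Nat.lt_succ_iff_lt_or_eq.1 hc with hc | rfl
    · have := h c hc
      simp [hx, Function.update_of_ne hc.ne, this]
    · simp [hx]
  have hn1 : col s₁ Arr.students 0 = n := by rw [hs₁, col_run _ _ (by decide), hn]
  have hm1 : col s₁ Arr.seminars 0 = m := by rw [hs₁, col_run _ _ (by decide), hm]
  clear_value s₁
  set s₂ := ForProg.run _ s₁ with hs₂
  have hr2 : s₂.real = s₁.real := by
    funext a
    rw [hs₂]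
    exact real_run_of_notMem _ (by simp [realWrites, block, setEntry]) _
  have hrc2 : rcol s₂ = rcol s₁ := by
    funext a i
    rw [rcol, hr2, rcol]
  set W := s₁.real Arr.profit with hW
  have h2 : (∀ i < n, col s₂ Arr.asg i ≤ m ∧ ∀ c ≤ m, W i c ≤ W i (col s₂ Arr.asg i)) ∧
      ∀ c ≤ m, col s₂ Arr.cnt c = load n (col s₂ Arr.asg) c := by
    rw [hs₂]
    refine run_loop_spec rfl s₁ (N := n) (by simp [hn1])
      (fun j s' => (∀ i < j, col s' Arr.asg i ≤ m ∧ ∀ c ≤ m, W i c ≤ W i (col s' Arr.asg i)) ∧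
        ∀ c ≤ m, col s' Arr.cnt c = load j (col s' Arr.asg) c)
      (fun j s' v h => by simpa using h)
      ⟨fun i hi => by omega, fun c hc => by simp [load, h1 c (by omega)]⟩ ?_
    intro j hj s' ⟨hA, hc⟩ hx hfn hfr
    have hmm : col s' Arr.seminars 0 = m := by rw [hfn _ (by decide), hm1]
    have hWW : s'.real Arr.profit = W := hfr _ (by decide)
    simp only [run_block_cons, run_block_singleton, run_setEntry, eval_reg, hx, NatExpr.eval]
    set s₃ := ForProg.run _ (s'.writeNat Arr.asg j 0 0) with hs₃
    have hx3 : col s₃ Arr.loopStu 0 = j := by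
      rw [hs₃, col_run _ _ (by decide)]
      simpa using hx
    have hcnt3 : col s₃ Arr.cnt = col s' Arr.cnt := by
      rw [hs₃, col_run _ _ (by decide)]
      simp
    have h3 : (col s₃ Arr.asg j ≤ m ∧ ∀ c < m + 1, W j c ≤ W j (col s₃ Arr.asg j)) ∧
        ∀ i ≠ j, col s₃ Arr.asg i = col s' Arr.asg i := by
      rw [hs₃]
      refine run_loop_spec rfl _ (N := m + 1) (by simp [hmm])
        (fun c s'' => (col s'' Arr.asg j ≤ m ∧ ∀ d < c, W j d ≤ W j (col s'' Arr.asg j)) ∧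
          ∀ i ≠ j, col s'' Arr.asg i = col s' Arr.asg i)
        (fun j s' v h => by simpa using h) ?_ ?_
      · refine ⟨by simp, fun i hi => by simp [hi]⟩
      · intro c hc s'' ⟨⟨ha, hb⟩, hd⟩ hx'' hfn' hfr'
        have hj'' : col s'' Arr.loopStu 0 = j := by
          rw [hfn' _ (by decide)]
          simpa using hx
        have hW'' : s''.real Arr.profit = W := by
          rw [hfr' _ (by decide)]
          exact hWW
        simp only [run_branch, Test.Holds, eval_profitExpr, hW'', eval_reg, eval_entry, hj'', hx'']
        split_ifs with ht
        · simp only [run_setEntry, eval_reg, hj'', hx'', col_writeNat_self, Function.update_self]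
          refine ⟨⟨by omega, fun d hd => ?_⟩, fun i hi => ?_⟩
          · rcases Nat.lt_succ_iff_lt_or_eq.1 hd with hd | rfl
            · exact (hb d hd).trans ht
            · exact le_rfl
          · rw [Function.update_of_ne hi, hd i hi]
        · refine ⟨⟨ha, fun d hd => ?_⟩, hd⟩
          rcases Nat.lt_succ_iff_lt_or_eq.1 hd with hd | rfl
          · exact hb d hd
          · exact (not_le.1 ht).le
    clear_value s₃
    obtain ⟨⟨ha, hb⟩, hd⟩ := h3
    have easg : ∀ d e, col (s₃.writeNat Arr.cnt d 0 e) Arr.asg = col s₃ Arr.asg :=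
      fun _ _ => col_writeNat_of_ne _ (by decide) _ _
    simp only [eval_entry, eval_reg, hx3, easg]
    refine ⟨fun i hi => ?_, fun c hcm => ?_⟩
    · rcases Nat.lt_succ_iff_lt_or_eq.1 hi with hi | rfl
      · rw [hd i hi.ne]
        exact hA i hi
      · exact ⟨ha, fun c hc => hb c (by omega)⟩
    · simp only [col_writeNat_self]
      rw [load_succ, load_congr (fun i hi => hd i (ne_of_lt hi)), ← hc c hcm, hcnt3,
        Function.update_apply]
      split_ifs with h
      · rw [h]
      · rfl
  refine ⟨⟨fun i hi => (h2.1 i hi).1, fun i hi c hc => ?_, fun c hc => ?_, fun c hc _ => ?_⟩, h2.2⟩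
  · rw [hrc2, hr2, (h1 c (by omega)).1, (h1 _ (Nat.lt_succ_iff.2 (h2.1 i hi).1)).1]
    simpa using (h2.1 i hi).2 c hc
  · rw [hrc2, (h1 c (by omega)).1]
  · rw [hrc2, (h1 c (by omega)).1]

/-! ### Growing a tree -/

/-- Search for an option `src` with too many students; `src` becomes `m + 1` if there is none. -/
def findSrc : ForProg := block [
  setReg Arr.src (.plus (reg Arr.seminars) (.const 1)),
  loop Arr.loopOpt .seminars (branch
    (.neg (.natLe (entry Arr.cnt (reg Arr.loopOpt)) (entry Arr.cap (reg Arr.loopOpt))))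
    (setReg Arr.src (reg Arr.loopOpt))
    skip)]

theorem findSrc_spec {m : ℕ} (s : Store) (hm : col s Arr.seminars 0 = m) :
    (col (findSrc.run s) Arr.src 0 = m + 1 ∧ ∀ c ≤ m, col s Arr.cnt c ≤ col s Arr.cap c) ∨
      ∃ c ≤ m, col (findSrc.run s) Arr.src 0 = c ∧ col s Arr.cap c < col s Arr.cnt c := by
  have key : (col (findSrc.run s) Arr.src 0 = m + 1 ∧
      ∀ c < m + 1, col s Arr.cnt c ≤ col s Arr.cap c) ∨
      ∃ c ≤ m, col (findSrc.run s) Arr.src 0 = c ∧ col s Arr.cap c < col s Arr.cnt c := by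
    refine run_loop_spec rfl _ (N := m + 1) (by simp [hm])
      (fun j s' => (col s' Arr.src 0 = m + 1 ∧ ∀ c < j, col s Arr.cnt c ≤ col s Arr.cap c) ∨
        ∃ c ≤ m, col s' Arr.src 0 = c ∧ col s Arr.cap c < col s Arr.cnt c)
      (fun j s' v h => by simpa using h) (Or.inl ⟨by simp [hm], fun c hc => by omega⟩) ?_
    intro j hj s' h hx hfn _
    have hcnt : col s' Arr.cnt = col s Arr.cnt := by
      rw [hfn _ (by decide)]
      simp
    have hcap : col s' Arr.cap = col s Arr.cap := by
      rw [hfn _ (by decide)]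
      simp
    simp only [run_branch, Test.Holds, eval_entry, eval_reg, hx, hcnt, hcap]
    split_ifs with ht
    · rcases h with ⟨h1, h2⟩ | h
      · refine Or.inl ⟨h1, fun c hc => ?_⟩
        rcases Nat.lt_succ_iff_lt_or_eq.1 hc with hc | rfl
        · exact h2 c hc
        · exact ht
      · exact Or.inr h
    · exact Or.inr ⟨j, by omega, by simp [hx], by omega⟩
  rcases key with ⟨h1, h2⟩ | h
  · exact Or.inl ⟨h1, fun c hc => h2 c (by omega)⟩
  · exact Or.inr h

/-- The expression for `regret`. -/
def regretExpr (j c : NatExpr) : RealExpr :=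
  .plus (.minus (.minus (profitExpr j (entry Arr.asg j)) (rentry Arr.price (entry Arr.asg j)))
    (profitExpr j c)) (rentry Arr.price c)

@[simp] theorem eval_regretExpr (s : Store) (j c : NatExpr) :
    (regretExpr j c).eval s =
      regret (s.real Arr.profit) (col s Arr.asg) (rcol s Arr.price) (j.eval s) (c.eval s) := rfl

/-- Consider the student and the option that the loop counters point to. -/
def considerLeaving : ForProg :=
  branch (.both (.natLe (.const 1) (entry Arr.tree (entry Arr.asg (reg Arr.loopStu))))
      (.both (.neg (.natLe (.const 1) (entry Arr.tree (reg Arr.loopOpt))))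
        (.neg (.both (.natLe (.const 1) (reg Arr.found))
          (.realLe (regretExpr (reg Arr.stu) (reg Arr.opt))
            (regretExpr (reg Arr.loopStu) (reg Arr.loopOpt)))))))
    (block [
      setReg Arr.found (.const 1),
      setReg Arr.stu (reg Arr.loopStu),
      setReg Arr.opt (reg Arr.loopOpt)])
    skip

/-- Among the students in the tree and the options outside, find a pair of least regret. -/
def findLeaving : ForProg := block [
  setReg Arr.found (.const 0),
  loop Arr.loopStu .students (loop Arr.loopOpt .seminars considerLeaving)]

/-- The registers `stu` and `opt` hold a pair of least regret among the pairs in `vis`, if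
there is a pair. -/
def Scanned (n m : ℕ) (W : ℕ → ℕ → ℝ) (A : ℕ → ℕ) (v : ℕ → ℝ) (T : Finset ℕ)
    (vis : ℕ → ℕ → Prop) (s : Store) : Prop :=
  (col s Arr.found 0 = 0 ∧ ∀ j c, vis j c → ¬ Leaving n m A T j c) ∨
    (col s Arr.found 0 = 1 ∧ Leaving n m A T (col s Arr.stu 0) (col s Arr.opt 0) ∧
      ∀ j c, vis j c → Leaving n m A T j c →
        regret W A v (col s Arr.stu 0) (col s Arr.opt 0) ≤ regret W A v j c)

theorem Scanned.mono {n m : ℕ} {W : ℕ → ℕ → ℝ} {A : ℕ → ℕ} {v : ℕ → ℝ} {T : Finset ℕ}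
    {vis vis' : ℕ → ℕ → Prop} {s : Store} (h : Scanned n m W A v T vis s)
    (hv : ∀ j c, Leaving n m A T j c → vis' j c → vis j c) : Scanned n m W A v T vis' s := by
  rcases h with ⟨h1, h2⟩ | ⟨h1, h2, h3⟩
  · exact Or.inl ⟨h1, fun j c hvis hl => h2 j c (hv j c hl hvis) hl⟩
  · exact Or.inr ⟨h1, h2, fun j c hvis hl => h3 j c (hv j c hl hvis) hl⟩

/-- The array `tree` holds the indicator function of `T`. -/
def HoldsTree (m : ℕ) (T : Finset ℕ) (s : Store) : Prop :=
  ∀ c ≤ m, col s Arr.tree c = if c ∈ T then 1 else 0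

theorem HoldsTree.one_le {m : ℕ} {T : Finset ℕ} {s : Store} (h : HoldsTree m T s) {c : ℕ}
    (hc : c ≤ m) : 1 ≤ col s Arr.tree c ↔ c ∈ T := by
  rw [h c hc]
  split_ifs with h <;> simp [h]

theorem Scanned.considerLeaving {n m : ℕ} {W : ℕ → ℕ → ℝ} {A : ℕ → ℕ} {v : ℕ → ℝ} {T : Finset ℕ}
    {vis : ℕ → ℕ → Prop} {s : Store} (h : Scanned n m W A v T vis s) (hT : HoldsTree m T s)
    (hW : s.real Arr.profit = W) (hasg : col s Arr.asg = A) (hv : rcol s Arr.price = v)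
    {j c : ℕ} (hj : j < n) (hAj : A j ≤ m) (hc : c ≤ m) (hjx : col s Arr.loopStu 0 = j)
    (hcx : col s Arr.loopOpt 0 = c) :
    Scanned n m W A v T (fun i d => vis i d ∨ i = j ∧ d = c) (considerLeaving.run s) := by
  simp only [SAP.considerLeaving, run_branch, Test.Holds, eval_entry, eval_reg, NatExpr.eval, hasg,
    hjx, hcx, hT.one_le hAj, hT.one_le hc, eval_regretExpr, hW, hv]
  split_ifs with ht
  · obtain ⟨h1, h2, h3⟩ := ht
    have hl : Leaving n m A T j c := ⟨hj, hc, h1, h2⟩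
    right
    have e1 : col ((block [
      setReg Arr.found (.const 1),
      setReg Arr.stu (reg Arr.loopStu),
      setReg Arr.opt (reg Arr.loopOpt)]).run s) Arr.stu 0 = j := by simp [hjx]
    have e2 : col ((block [
      setReg Arr.found (.const 1),
      setReg Arr.stu (reg Arr.loopStu),
      setReg Arr.opt (reg Arr.loopOpt)]).run s) Arr.opt 0 = c := by simp [hcx]
    rw [e1, e2]
    refine ⟨by simp, hl, ?_⟩
    rintro i d (hvis | ⟨rfl, rfl⟩) hl'
    · rcases h with ⟨_, h⟩ | ⟨h4, _, h5⟩
      · exact absurd hl' (h i d hvis)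
      · have h6 := h5 i d hvis hl'
        have h7 := not_and.1 h3 (by omega)
        exact (not_le.1 h7).le.trans h6
    · exact le_rfl
  · rcases h with ⟨h1, h2⟩ | ⟨h1, h2, h3⟩
    · refine Or.inl ⟨h1, ?_⟩
      rintro i d (hvis | ⟨rfl, rfl⟩)
      · exact h2 i d hvis
      · rintro ⟨_, _, h3, h4⟩
        exact ht ⟨h3, h4, fun h5 => by omega⟩
    · refine Or.inr ⟨h1, h2, ?_⟩
      rintro i d (hvis | ⟨rfl, rfl⟩) hl
      · exact h3 i d hvis hl
      · by_contra h4
        exact ht ⟨hl.2.2.1, hl.2.2.2, fun h5 => h4 h5.2⟩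

theorem findLeaving_spec {n m : ℕ} (s : Store) {T : Finset ℕ} (hn : col s Arr.students 0 = n)
    (hm : col s Arr.seminars 0 = m) (hT : HoldsTree m T s) (hA : ∀ i < n, col s Arr.asg i ≤ m)
    (hex : ∃ j c, Leaving n m (col s Arr.asg) T j c) :
    Leaving n m (col s Arr.asg) T (col (findLeaving.run s) Arr.stu 0)
        (col (findLeaving.run s) Arr.opt 0) ∧
      ∀ j c, Leaving n m (col s Arr.asg) T j c →
        regret (s.real Arr.profit) (col s Arr.asg) (rcol s Arr.price)
          (col (findLeaving.run s) Arr.stu 0) (col (findLeaving.run s) Arr.opt 0) ≤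
        regret (s.real Arr.profit) (col s Arr.asg) (rcol s Arr.price) j c := by
  set W := s.real Arr.profit with hW
  set A := col s Arr.asg with hAdef
  set v := rcol s Arr.price with hv
  have key : Scanned n m W A v T (fun i _ => i < n) (findLeaving.run s) := by
    refine run_loop_spec rfl _ (N := n) (by simp [hn])
      (fun j s' => Scanned n m W A v T (fun i _ => i < j) s')
      (fun j s' v h => by simpa [Scanned] using h)
      (Or.inl ⟨by simp, fun j c hj => by omega⟩) ?_
    intro j hj s' h hx hfn hfr
    have hm' : col s' Arr.seminars 0 = m := by
      rw [hfn _ (by decide)]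
      simpa using hm
    refine Scanned.mono (vis := fun i d => i < j ∨ i = j ∧ d < m + 1) ?_ (fun i c hl hi => by
      have := hl.2.1
      omega)
    refine run_loop_spec rfl _ (N := m + 1) (by simp [hm'])
      (fun c s'' => Scanned n m W A v T (fun i d => i < j ∨ i = j ∧ d < c) s'')
      (fun j s' v h => by simpa [Scanned] using h) (h.mono fun i c _ hi => by omega) ?_
    intro c hc s'' h'' hx'' hfn'' hfr''
    refine Scanned.mono (Scanned.considerLeaving h'' (j := j) (c := c) ?_ ?_ ?_ ?_ hj (hA j hj)
      (by omega) ?_ hx'') fun i d _ hi => by omega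
    · intro d hd
      rw [hfn'' _ (by decide), hfn _ (by decide)]
      simpa using hT d hd
    · rw [hfr'' _ (by decide), hfr _ (by decide)]
      rfl
    · rw [hfn'' _ (by decide), hfn _ (by decide)]
      simp [hAdef]
    · funext i
      rw [rcol, hfr'' _ (by decide), hfr _ (by decide)]
      rfl
    · rw [hfn'' _ (by decide), hx]
  obtain ⟨j, c, hl⟩ := hex
  rcases key with ⟨_, h⟩ | ⟨_, h1, h2⟩
  · exact absurd hl (h j c hl.1)
  · exact ⟨h1, fun j c hl => h2 j c hl.1 hl⟩

/-- Raise the prices in the tree by the regret of the pair in `stu` and `opt`, and let the option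
`opt` join the tree. -/
def raisePrices : ForProg := block [
  setRReg Arr.raise (regretExpr (reg Arr.stu) (reg Arr.opt)),
  loop Arr.loopOpt .seminars (branch
    (.natLe (.const 1) (entry Arr.tree (reg Arr.loopOpt)))
    (setREntry Arr.price (reg Arr.loopOpt)
      (.plus (rentry Arr.price (reg Arr.loopOpt)) (rreg Arr.raise)))
    skip),
  setEntry Arr.tree (reg Arr.opt) (.const 1),
  setEntry Arr.par (reg Arr.opt) (reg Arr.stu),
  setReg Arr.tip (reg Arr.opt)]

theorem rcol_raisePrices {m : ℕ} (s : Store) {T : Finset ℕ} (hm : col s Arr.seminars 0 = m)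
    (hT : HoldsTree m T s) (hTm : ∀ c ∈ T, c ≤ m) :
    rcol (raisePrices.run s) Arr.price = fun c => if c ∈ T then rcol s Arr.price c +
      regret (s.real Arr.profit) (col s Arr.asg) (rcol s Arr.price) (col s Arr.stu 0)
        (col s Arr.opt 0) else rcol s Arr.price c := by
  simp only [raisePrices, run_block_cons, run_block_singleton, run_setEntry, run_setReg,
    rcol_writeNat, run_setRReg, eval_regretExpr, eval_reg]
  set δ := regret (s.real Arr.profit) (col s Arr.asg) (rcol s Arr.price) (col s Arr.stu 0)
    (col s Arr.opt 0) with hδ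
  set s₁ := ForProg.run _ (s.writeReal Arr.raise 0 0 δ) with hs₁
  have key : ∀ c, rcol s₁ Arr.price c = if c < m + 1 ∧ c ∈ T then rcol s Arr.price c + δ
      else rcol s Arr.price c := by
    rw [hs₁]
    refine run_loop_spec rfl _ (N := m + 1) (by simp [hm])
      (fun j s' => ∀ c, rcol s' Arr.price c = if c < j ∧ c ∈ T then rcol s Arr.price c + δ
        else rcol s Arr.price c)
      (fun j s' v h => by simpa using h) (fun c => by simp) ?_
    intro j hj s' h hx hfn hfr
    have hT' : 1 ≤ col s' Arr.tree j ↔ j ∈ T := by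
      rw [hfn _ (by decide), col_writeReal]
      exact hT.one_le (by omega)
    have hδ' : rcol s' Arr.raise 0 = δ := by
      rw [rcol, hfr _ (by decide)]
      simp
    intro c
    simp only [run_branch, Test.Holds, eval_entry, eval_reg, NatExpr.eval, hx, hT']
    have hjc := h c
    by_cases hcj : c = j
    · subst hcj
      rw [if_neg (by omega)] at hjc
      split_ifs with h1 h2 h2
      · simp [hx, hjc, hδ']
      · exact absurd ⟨by omega, h1⟩ h2
      · exact absurd h2.2 h1
      · simpa using hjc
    · have e : c < j + 1 ∧ c ∈ T ↔ c < j ∧ c ∈ T := by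
        constructor <;> rintro ⟨h1, h2⟩ <;> exact ⟨by omega, h2⟩
      simp only [e, ← hjc]
      split_ifs
      · simp [hx, Function.update_of_ne hcj]
      · rfl
  funext c
  rw [key]
  have e : c < m + 1 ∧ c ∈ T ↔ c ∈ T := ⟨fun h => h.2, fun h => ⟨Nat.lt_succ_iff.2 (hTm c h), h⟩⟩
  simp only [e]

theorem col_raisePrices (s : Store) :
    col (raisePrices.run s) Arr.tree = Function.update (col s Arr.tree) (col s Arr.opt 0) 1 ∧
    col (raisePrices.run s) Arr.par =
      Function.update (col s Arr.par) (col s Arr.opt 0) (col s Arr.stu 0) ∧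
    col (raisePrices.run s) Arr.tip 0 = col s Arr.opt 0 := by
  simp only [raisePrices, run_block_cons, run_block_singleton, run_setEntry, run_setReg]
  set s₁ := ForProg.run (loop _ _ _) _ with hs₁
  have h1 : col s₁ Arr.tree = col s Arr.tree := by rw [hs₁, col_run _ _ (by decide)]; simp
  have h2 : col s₁ Arr.par = col s Arr.par := by rw [hs₁, col_run _ _ (by decide)]; simp
  have h3 : col s₁ Arr.opt = col s Arr.opt := by rw [hs₁, col_run _ _ (by decide)]; simp
  have h4 : col s₁ Arr.stu = col s Arr.stu := by rw [hs₁, col_run _ _ (by decide)]; simp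
  clear_value s₁
  simp [h1, h2, h3, h4]

/-- Grow the tree by one option. -/
def growStep : ForProg := .seq findLeaving raisePrices

/-- The memory holds an alternating tree with `T` as set of options. -/
def TreeState (n m : ℕ) (T : Finset ℕ) (s : Store) : Prop :=
  HoldsTree m T s ∧ ∃ rank, Tree n m (s.real Arr.profit) (col s Arr.cap) (col s Arr.asg)
    (rcol s Arr.price) (col s Arr.src 0) T (col s Arr.par) rank (col s Arr.tip 0)

theorem TreeState.growStep {n m : ℕ} {s : Store} {T : Finset ℕ} (h : TreeState n m T s)
    (hM : Matching n m s) (hn : col s Arr.students 0 = n) (hm : col s Arr.seminars 0 = m)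
    (hcap : n ≤ ∑ c ∈ range (m + 1), col s Arr.cap c)
    (hsrc : col s Arr.cap (col s Arr.src 0) < load n (col s Arr.asg) (col s Arr.src 0))
    (htip : col s Arr.cap (col s Arr.tip 0) ≤ load n (col s Arr.asg) (col s Arr.tip 0)) :
    Matching n m (growStep.run s) ∧ ∃ c ∉ T, TreeState n m (insert c T) (growStep.run s) := by
  obtain ⟨hT, rank, ht⟩ := h
  have hl := ht.exists_leaving hM.supported.le hcap hsrc htip
  obtain ⟨hl1, hl2⟩ := findLeaving_spec s hn hm hT hM.supported.le hl
  have hm1 : col (findLeaving.run s) Arr.seminars 0 = m := by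
    rw [col_run _ _ (by decide), hm]
  have hT1 : HoldsTree m T (findLeaving.run s) := by
    intro c hc
    rw [col_run _ _ (by decide)]
    exact hT c hc
  have hp := rcol_raisePrices (findLeaving.run s) hm1 hT1 ht.le
  obtain ⟨hc1, hc2, hc3⟩ := col_raisePrices (findLeaving.run s)
  have g := ht.grow hM.supported htip hl1 hl2
  rw [real_run_of_notMem findLeaving (a := Arr.profit) (by decide),
    rcol_run findLeaving _ (a := Arr.price) (by decide),
    col_run findLeaving _ (a := Arr.asg) (by decide)] at hp
  rw [col_run findLeaving _ (a := Arr.par) (by decide)] at hc2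
  have e1 : (raisePrices.run (findLeaving.run s)).real Arr.profit = s.real Arr.profit := by
    rw [real_run_of_notMem _ (by decide), real_run_of_notMem _ (by decide)]
  have e2 : ∀ a ∈ [Arr.cap, Arr.asg, Arr.cnt, Arr.src],
      col (raisePrices.run (findLeaving.run s)) a = col s a := by
    intro a ha
    rw [col_run raisePrices _ (a := a) (by revert a; decide),
      col_run findLeaving _ (a := a) (by revert a; decide)]
  simp only [SAP.growStep, run_seq]
  refine ⟨⟨?_, ?_⟩, _, hl1.2.2.2, ?_,
    Function.update rank (col (findLeaving.run s) Arr.opt 0) T.card, ?_⟩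
  · rw [e1, e2 _ (by decide), e2 _ (by decide), hp]
    exact g.1
  · rw [e2 _ (by decide), e2 _ (by decide)]
    exact hM.cnt
  · intro c hc
    rw [hc1, Function.update_apply, hT1 c hc]
    simp only [mem_insert]
    by_cases h : c = col (findLeaving.run s) Arr.opt 0 <;> simp [h]
  · rw [e1, e2 _ (by decide), e2 _ (by decide), e2 _ (by decide), hp, hc2, hc3]
    exact g.2

/-- Grow a tree from the overfull option `src` until its tip has a free place. -/
def growTree : ForProg := block [
  loop Arr.loopOpt .seminars (setEntry Arr.tree (reg Arr.loopOpt) (.const 0)),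
  setEntry Arr.tree (reg Arr.src) (.const 1),
  setReg Arr.tip (reg Arr.src),
  loop Arr.loopPath .seminars (branch
    (.natLe (entry Arr.cap (reg Arr.tip)) (entry Arr.cnt (reg Arr.tip))) growStep skip)]

theorem growTree_spec {n m : ℕ} {s : Store} (hM : Matching n m s) (hn : col s Arr.students 0 = n)
    (hm : col s Arr.seminars 0 = m) (hcap : n ≤ ∑ c ∈ range (m + 1), col s Arr.cap c)
    (hsm : col s Arr.src 0 ≤ m)
    (hsrc : col s Arr.cap (col s Arr.src 0) < load n (col s Arr.asg) (col s Arr.src 0)) :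
    Matching n m (growTree.run s) ∧ ∃ T, TreeState n m T (growTree.run s) ∧
      load n (col s Arr.asg) (col (growTree.run s) Arr.tip 0) <
        col s Arr.cap (col (growTree.run s) Arr.tip 0) := by
  simp only [growTree, run_block_cons, run_block_singleton, run_setEntry, run_setReg]
  set s₁ := ForProg.run _ s with hs₁
  have h1 : ∀ c < m + 1, col s₁ Arr.tree c = 0 := by
    refine run_loop_spec rfl s (N := m + 1) (by simp [hm])
      (fun j s' => ∀ c < j, col s' Arr.tree c = 0)
      (fun j s' v h => by simpa using h) (fun c hc => by omega) ?_
    intro j hj s' h hx hfn hfr c hc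
    rcases Nat.lt_succ_iff_lt_or_eq.1 hc with hc | rfl
    · simp [hx, Function.update_of_ne hc.ne, h c hc]
    · simp [hx]
  have f1 : ∀ a ∈ [Arr.students, Arr.seminars, Arr.cap, Arr.asg, Arr.cnt, Arr.src, Arr.par],
      col s₁ a = col s a := fun a ha => col_run _ _ (by revert a; decide)
  have g1 : s₁.real = s.real := by
    funext a
    exact real_run_of_notMem _ (by simp [realWrites, setEntry]) _
  clear_value s₁
  simp only [eval_reg, NatExpr.eval]
  rw [f1 Arr.src (by decide), col_writeNat_of_ne _ (by decide), f1 Arr.src (by decide)]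
  set s₂ := (s₁.writeNat Arr.tree (col s Arr.src 0) 0 1).writeNat Arr.tip 0 0 (col s Arr.src 0)
    with hs₂
  have f2 : ∀ a ∈ [Arr.students, Arr.seminars, Arr.cap, Arr.asg, Arr.cnt, Arr.src],
      col s₂ a = col s a := by
    intro a ha
    rw [hs₂, col_writeNat_of_ne _ (by revert a; decide), col_writeNat_of_ne _ (by revert a; decide)]
    exact f1 a (by revert a; decide)
  have hpr2 : s₂.real Arr.profit = s.real Arr.profit := by rw [← g1]; rfl
  have hrc2 : rcol s₂ Arr.price = rcol s Arr.price := by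
    funext i
    rw [rcol, rcol, ← g1]
    rfl
  have htip2 : col s₂ Arr.tip 0 = col s Arr.src 0 := by simp [hs₂]
  have htree2 : HoldsTree m {col s Arr.src 0} s₂ := by
    intro c hc
    have : col s₂ Arr.tree = Function.update (col s₁ Arr.tree) (col s Arr.src 0) 1 := by simp [hs₂]
    rw [this, Function.update_apply, h1 c (by omega)]
    simp
  have hM2 : Matching n m s₂ := by
    constructor
    · rw [hpr2, hrc2, f2 _ (by decide), f2 _ (by decide)]
      exact hM.supported
    · rw [f2 _ (by decide), f2 _ (by decide)]
      exact hM.cnt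
  have hTS2 : TreeState n m {col s Arr.src 0} s₂ := by
    refine ⟨htree2, fun _ => 0, ?_⟩
    rw [f2 Arr.src (by decide), htip2]
    exact Tree.single hsm _
  clear_value s₂
  have key : ∀ s₃, s₃ = ForProg.run (loop Arr.loopPath .seminars (branch
      (.natLe (entry Arr.cap (reg Arr.tip)) (entry Arr.cnt (reg Arr.tip))) growStep skip)) s₂ →
      Matching n m s₃ ∧ ∃ T, TreeState n m T s₃ ∧ (T.card = m + 1 + 1 ∨
        load n (col s Arr.asg) (col s₃ Arr.tip 0) < col s Arr.cap (col s₃ Arr.tip 0)) := by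
    rintro _ rfl
    refine run_loop_spec rfl s₂ (N := m + 1) (by simp [f2, hm])
      (fun t s' => Matching n m s' ∧ ∃ T, TreeState n m T s' ∧ (T.card = t + 1 ∨
        load n (col s Arr.asg) (col s' Arr.tip 0) < col s Arr.cap (col s' Arr.tip 0)))
      (fun j s' v h => ?_) ⟨hM2, _, hTS2, Or.inl (by simp)⟩ ?_
    · obtain ⟨h1, T, h2, h3⟩ := h
      refine ⟨⟨by simpa using h1.supported, by simpa using h1.cnt⟩, T, ?_, by simpa using h3⟩
      simpa [TreeState, HoldsTree] using h2
    · intro t ht s' ⟨hM', T, hTS, h⟩ hx hfn hfr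
      have f : ∀ a ∈ [Arr.students, Arr.seminars, Arr.cap, Arr.asg, Arr.src],
          col s' a = col s a := by
        intro a ha
        rw [hfn a (by revert a; decide)]
        exact f2 a (by revert a; decide)
      have htm : col s' Arr.tip 0 ≤ m := hTS.2.elim fun _ h => h.le _ h.tip_mem
      have hc := hM'.cnt _ htm
      rw [f Arr.asg (by decide)] at hc
      simp only [run_branch, Test.Holds, eval_entry, eval_reg, f Arr.cap (by decide), hc]
      split_ifs with hle
      · obtain ⟨g1, c, hcT, g2⟩ := hTS.growStep hM' (by rw [f _ (by decide), hn])
          (by rw [f _ (by decide), hm]) (by rw [f Arr.cap (by decide)]; exact hcap)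
          (by rw [f Arr.cap (by decide), f Arr.src (by decide), f Arr.asg (by decide)]; exact hsrc)
          (by rw [f Arr.cap (by decide), f Arr.asg (by decide)]; exact hle)
        refine ⟨g1, _, g2, Or.inl ?_⟩
        rw [card_insert_of_notMem hcT]
        omega
      · exact ⟨hM', T, hTS, Or.inr (not_le.1 hle)⟩
  obtain ⟨h1, T, h2, h3⟩ := key _ rfl
  refine ⟨h1, T, h2, h3.resolve_left fun hcard => ?_⟩
  obtain ⟨_, _, ht⟩ := h2
  have : T.card ≤ (range (m + 1)).card :=
    card_le_card fun c hc => mem_range.2 (Nat.lt_succ_iff.2 (ht.le c hc))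
  rw [card_range] at this
  omega

/-! ### Shifting along a path -/

/-- Shift the students along the path from the source to the tip of the tree. -/
def shiftPath : ForProg :=
  loop Arr.loopPath .seminars (branch
    (.both (.natLe (reg Arr.tip) (reg Arr.src)) (.natLe (reg Arr.src) (reg Arr.tip)))
    skip
    (block [
      setReg Arr.stu (entry Arr.par (reg Arr.tip)),
      setReg Arr.old (entry Arr.asg (reg Arr.stu)),
      setEntry Arr.asg (reg Arr.stu) (reg Arr.tip),
      setEntry Arr.cnt (reg Arr.tip) (.plus (entry Arr.cnt (reg Arr.tip)) (.const 1)),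
      setEntry Arr.cnt (reg Arr.old) (.minus (entry Arr.cnt (reg Arr.old)) (.const 1)),
      setReg Arr.tip (reg Arr.old)]))

theorem shiftPath_spec {n m : ℕ} {s : Store} {T : Finset ℕ} (hM : Matching n m s)
    (hm : col s Arr.seminars 0 = m) (hTS : TreeState n m T s)
    (hsrc : col s Arr.cap (col s Arr.src 0) < load n (col s Arr.asg) (col s Arr.src 0))
    (htip : load n (col s Arr.asg) (col s Arr.tip 0) < col s Arr.cap (col s Arr.tip 0)) :
    Matching n m (shiftPath.run s) ∧
      excess n m (col s Arr.cap) (col (shiftPath.run s) Arr.asg) <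
        excess n m (col s Arr.cap) (col s Arr.asg) := by
  obtain ⟨hT, rank, ht⟩ := hTS
  have key : ∀ s₃, s₃ = shiftPath.run s →
      Shifting n m (s.real Arr.profit) (col s Arr.asg) (col s₃ Arr.asg) (rcol s Arr.price)
        (col s Arr.src 0) (col s Arr.tip 0) T (col s Arr.par) rank (col s₃ Arr.tip 0) ∧
      (∀ c ≤ m, col s₃ Arr.cnt c = load n (col s₃ Arr.asg) c) ∧
      (col s₃ Arr.tip 0 = col s Arr.src 0 ∨
        rank (col s₃ Arr.tip 0) + (m + 1) ≤ rank (col s Arr.tip 0)) := by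
    rintro _ rfl
    refine run_loop_spec rfl s (N := m + 1) (by simp [hm])
      (fun t s' => Shifting n m (s.real Arr.profit) (col s Arr.asg) (col s' Arr.asg)
          (rcol s Arr.price) (col s Arr.src 0) (col s Arr.tip 0) T (col s Arr.par) rank
          (col s' Arr.tip 0) ∧
        (∀ c ≤ m, col s' Arr.cnt c = load n (col s' Arr.asg) c) ∧
        (col s' Arr.tip 0 = col s Arr.src 0 ∨
          rank (col s' Arr.tip 0) + t ≤ rank (col s Arr.tip 0)))
      (fun j s' v h => by simpa using h) ⟨ht.shifting hM.supported, hM.cnt, Or.inr le_rfl⟩ ?_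
    intro t _ s' ⟨hS, hc, hr⟩ hx hfn hfr
    have fsrc : col s' Arr.src = col s Arr.src := hfn _ (by decide)
    have fpar : col s' Arr.par = col s Arr.par := hfn _ (by decide)
    simp only [run_branch, Test.Holds, eval_reg, fsrc]
    split_ifs with heq
    · exact ⟨hS, hc, Or.inl (le_antisymm heq.1 heq.2)⟩
    · have hne : col s' Arr.tip 0 ≠ col s Arr.src 0 := fun h => heq ⟨h.le, h.ge⟩
      have hr' := hr.resolve_left hne
      obtain ⟨g1, g2⟩ := hS.shift ht.le hne
      have hj := (hS.parent _ hS.mem hne le_rfl).1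
      have hold := (hS.parent _ hS.mem hne le_rfl).2.1
      set cur := col s' Arr.tip 0 with hcur
      set j := col s Arr.par cur with hjdef
      have easg : ∀ p q, p = ForProg.run (block [
          setReg Arr.stu (entry Arr.par (reg Arr.tip)),
          setReg Arr.old (entry Arr.asg (reg Arr.stu)),
          setEntry Arr.asg (reg Arr.stu) (reg Arr.tip),
          setEntry Arr.cnt (reg Arr.tip) (.plus (entry Arr.cnt (reg Arr.tip)) (.const 1)),
          setEntry Arr.cnt (reg Arr.old) (.minus (entry Arr.cnt (reg Arr.old)) (.const 1)),
          setReg Arr.tip (reg Arr.old)]) s' → q = col s' Arr.asg j →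
          col p Arr.asg = Function.update (col s' Arr.asg) j cur ∧ col p Arr.tip 0 = q ∧
          col p Arr.cnt = Function.update (Function.update (col s' Arr.cnt) cur
            (col s' Arr.cnt cur + 1)) q
              (Function.update (col s' Arr.cnt) cur (col s' Arr.cnt cur + 1) q - 1) := by
        rintro _ _ rfl rfl
        simp [fpar, ← hcur, ← hjdef]
      obtain ⟨e1, e2, e3⟩ := easg _ _ rfl rfl
      rw [e1, e2, e3]
      refine ⟨g1, fun c hcm => ?_, Or.inr (by omega)⟩
      have hl := load_update (col s' Arr.asg) hj cur c
      have hcc := hc c hcm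
      have hnec : col s' Arr.asg j ≠ cur := fun h => by
        rw [h] at g2
        omega
      by_cases h1 : c = col s' Arr.asg j
      · subst h1
        rw [Function.update_self, Function.update_of_ne hnec]
        rw [if_pos rfl, if_neg hnec] at hl
        omega
      · rw [Function.update_of_ne h1]
        rw [if_neg h1] at hl
        by_cases h2 : c = cur
        · subst h2
          rw [if_pos rfl] at hl
          rw [Function.update_self]
          omega
        · rw [if_neg h2] at hl
          rw [Function.update_of_ne h2]
          omega
  obtain ⟨h1, h2, h3⟩ := key _ rfl
  have hend : col (shiftPath.run s) Arr.tip 0 = col s Arr.src 0 := h3.resolve_right fun h => by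
    have h4 := ht.rank_lt _ ht.tip_mem
    have : T.card ≤ (range (m + 1)).card :=
      card_le_card fun c hc => mem_range.2 (Nat.lt_succ_iff.2 (ht.le c hc))
    rw [card_range] at this
    omega
  rw [hend] at h1
  obtain ⟨g1, g2⟩ := h1.finish hM.supported ht.le hsrc htip
  refine ⟨⟨?_, h2⟩, g2⟩
  rw [real_run_of_notMem shiftPath (a := Arr.profit) (by decide),
    rcol_run shiftPath s (a := Arr.price) (by decide),
    col_run shiftPath s (a := Arr.cap) (by decide)]
  exact g1

/-- Remove one student from an overfull option, if there is one. -/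
def round : ForProg := .seq findSrc
  (branch (.natLe (reg Arr.src) (reg Arr.seminars)) (.seq growTree shiftPath) skip)

theorem Matching.round {n m : ℕ} {s : Store} (hM : Matching n m s)
    (hn : col s Arr.students 0 = n) (hm : col s Arr.seminars 0 = m)
    (hcap : n ≤ ∑ c ∈ range (m + 1), col s Arr.cap c) :
    Matching n m (round.run s) ∧
      excess n m (col s Arr.cap) (col (round.run s) Arr.asg) ≤
        excess n m (col s Arr.cap) (col s Arr.asg) - 1 := by
  have f1 : ∀ a ∈ [Arr.students, Arr.seminars, Arr.cap, Arr.asg, Arr.cnt],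
      col (findSrc.run s) a = col s a := fun a ha => col_run _ _ (by revert a; decide)
  have hM1 : Matching n m (findSrc.run s) := by
    constructor
    · rw [real_run_of_notMem _ (by decide), rcol_run _ _ (by decide), f1 _ (by decide),
        f1 _ (by decide)]
      exact hM.supported
    · rw [f1 _ (by decide), f1 _ (by decide)]
      exact hM.cnt
  simp only [SAP.round, run_seq, run_branch, Test.Holds, eval_reg, f1 Arr.seminars (by decide), hm]
  rcases findSrc_spec s hm with ⟨h1, h2⟩ | ⟨c, hc, h1, h2⟩
  · rw [if_neg (by omega)]
    refine ⟨hM1, ?_⟩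
    have : excess n m (col s Arr.cap) (col (findSrc.run s) Arr.asg) = 0 := by
      rw [f1 _ (by decide)]
      refine sum_eq_zero fun c hc => ?_
      have hc := Nat.lt_succ_iff.1 (mem_range.1 hc)
      rw [← hM.cnt c hc]
      have := h2 c hc
      omega
    exact this.le.trans (Nat.zero_le _)
  · rw [if_pos (by omega)]
    rw [hM.cnt c hc] at h2
    have hsrc : col (findSrc.run s) Arr.cap (col (findSrc.run s) Arr.src 0) <
        load n (col (findSrc.run s) Arr.asg) (col (findSrc.run s) Arr.src 0) := by
      rw [h1, f1 _ (by decide), f1 _ (by decide)]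
      exact h2
    obtain ⟨g1, T, g2, g3⟩ := growTree_spec hM1 (by rw [f1 _ (by decide), hn])
      (by rw [f1 _ (by decide), hm]) (by rw [f1 _ (by decide)]; exact hcap) (by omega) hsrc
    have f2 : ∀ a ∈ [Arr.cap, Arr.asg, Arr.src, Arr.seminars],
        col (growTree.run (findSrc.run s)) a = col (findSrc.run s) a :=
      fun a ha => col_run _ _ (by revert a; decide)
    obtain ⟨k1, k2⟩ := shiftPath_spec g1
      (by rw [f2 _ (by decide), f1 _ (by decide), hm]) g2
      (by rw [f2 Arr.cap (by decide), f2 Arr.asg (by decide), f2 Arr.src (by decide)]; exact hsrc)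
      (by rw [f2 Arr.cap (by decide), f2 Arr.asg (by decide)]; exact g3)
    rw [f2 Arr.cap (by decide), f2 Arr.asg (by decide), f1 Arr.cap (by decide),
      f1 Arr.asg (by decide)] at k2
    exact ⟨k1, by omega⟩

/-- Compute an assignment of greatest profit that respects the capacities in the array `cap`, and
its profit in the register `val`. -/
def optimalMatching : ForProg := block [
  initMatching,
  loop Arr.loopRound .students round,
  setRReg Arr.val .zero,
  loop Arr.loopStu .students (setRReg Arr.val
    (.plus (rreg Arr.val) (profitExpr (reg Arr.loopStu) (entry Arr.asg (reg Arr.loopStu)))))]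

theorem optimalMatching_spec {n m : ℕ} (s : Store) (hn : col s Arr.students 0 = n)
    (hm : col s Arr.seminars 0 = m) (hcap : n ≤ ∑ c ∈ range (m + 1), col s Arr.cap c) :
    (∃ v, Supported n m (s.real Arr.profit) (col s Arr.cap)
      (col (optimalMatching.run s) Arr.asg) v) ∧
    Fits n m (col s Arr.cap) (col (optimalMatching.run s) Arr.asg) ∧
    rcol (optimalMatching.run s) Arr.val 0 =
      gain n (s.real Arr.profit) (col (optimalMatching.run s) Arr.asg) := by
  simp only [optimalMatching, run_block_cons, run_block_singleton, run_setRReg]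
  have f1 : ∀ a ∈ [Arr.students, Arr.seminars, Arr.cap],
      col (initMatching.run s) a = col s a := fun a ha => col_run _ _ (by revert a; decide)
  have hM1 := matching_initMatching s hn hm
  have hW1 : (initMatching.run s).real Arr.profit = s.real Arr.profit :=
    real_run_of_notMem _ (by decide) _
  generalize initMatching.run s = s₁ at *
  set s₂ := ForProg.run (loop Arr.loopRound .students round) s₁ with hs₂
  have h2 : Matching n m s₂ ∧ excess n m (col s Arr.cap) (col s₂ Arr.asg) ≤ n - n := by
    refine run_loop_spec rfl s₁ (N := n) (by simp [f1, hn])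
      (fun t s' => Matching n m s' ∧ excess n m (col s Arr.cap) (col s' Arr.asg) ≤ n - t)
      (fun j s' v h => ⟨⟨by simpa using h.1.supported, by simpa using h.1.cnt⟩,
        by simpa using h.2⟩) ⟨hM1, excess_le hM1.supported.le⟩ ?_
    intro t ht s' ⟨hM, he⟩ hx hfn hfr
    have f : ∀ a ∈ [Arr.students, Arr.seminars, Arr.cap], col s' a = col s a := by
      intro a ha
      rw [hfn a (by revert a; decide)]
      exact f1 a ha
    obtain ⟨g1, g2⟩ := hM.round (by rw [f _ (by decide), hn]) (by rw [f _ (by decide), hm])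
      (by rw [f _ (by decide)]; exact hcap)
    rw [f _ (by decide)] at g2
    exact ⟨g1, by omega⟩
  have f2 : ∀ a ∈ [Arr.students, Arr.seminars, Arr.cap], col s₂ a = col s a := by
    intro a ha
    rw [hs₂, col_run _ _ (by revert a; decide)]
    exact f1 a ha
  have hW2 : s₂.real Arr.profit = s.real Arr.profit := by
    rw [hs₂, real_run_of_notMem _ (by decide), hW1]
  clear_value s₂
  obtain ⟨hM2, he2⟩ := h2
  have hfit := load_le_of_excess_eq_zero (Nat.le_zero.1 (he2.trans (by omega)))
  have hsup := hM2.supported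
  rw [hW2, f2 Arr.cap (by decide)] at hsup
  set s₃ := ForProg.run _ (s₂.writeReal Arr.val 0 0 (RealExpr.eval s₂ .zero)) with hs₃
  have easg : col s₃ Arr.asg = col s₂ Arr.asg := by
    rw [hs₃, col_run _ _ (by decide), col_writeReal]
  rw [easg]
  refine ⟨⟨_, hsup⟩, hsup.fits hfit, ?_⟩
  refine run_loop_spec rfl _ (N := n) (by simp [f2, hn])
    (fun t s' => rcol s' Arr.val 0 = gain t (s.real Arr.profit) (col s₂ Arr.asg))
    (fun j s' v h => by simpa using h) (by simp [gain]) ?_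
  intro t ht s' h hx hfn hfr
  have e1 : col s' Arr.asg = col s₂ Arr.asg := by
    rw [hfn _ (by decide), col_writeReal]
  have e2 : s'.real Arr.profit = s.real Arr.profit := by
    rw [hfr _ (by decide), real_writeReal_of_ne _ (by decide), hW2]
  simp [gain, sum_range_succ, hx, e1, e2, h]

/-! ### The values of sets of seminars -/

theorem sum_capacity {m : ℕ} {k : ℕ → ℕ} (r : ℕ) {S : Finset ℕ} (hS : S ⊆ range m) :
    ∑ c ∈ range (m + 1), capacity m k r S c = ∑ c ∈ S, k c + r := by
  rw [sum_range_succ, sum_range_capacity r hS]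
  simp [capacity]

theorem Supported.congr {n m : ℕ} {W : ℕ → ℕ → ℝ} {cap cap' A : ℕ → ℕ} {v : ℕ → ℝ}
    (h : Supported n m W cap A v) (hc : ∀ c ≤ m, cap c = cap' c) : Supported n m W cap' A v :=
  ⟨h.le, h.best, h.nonneg, fun c hcm hlt => h.price_eq_zero c hcm (by rwa [hc c hcm])⟩

theorem Fits.congr {n m : ℕ} {cap cap' A : ℕ → ℕ} (h : Fits n m cap A)
    (hc : ∀ c ≤ m, cap c = cap' c) : Fits n m cap' A :=
  ⟨h.le, fun c hcm => by rw [← hc c hcm]; exact h.load_le c hcm⟩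

/-- Strong duality for the assignment problem. The program for optimal assignments computes prices
that prove it, so it is enough to run the program on a memory that holds the given data. -/
theorem exists_supported_fits {n m : ℕ} (W : ℕ → ℕ → ℝ) {cap : ℕ → ℕ}
    (hcap : n ≤ ∑ c ∈ range (m + 1), cap c) :
    ∃ A v, Supported n m W cap A v ∧ Fits n m cap A := by
  let s : Store :=
    ⟨fun a i _ => if a = Arr.students then n else if a = Arr.seminars then m else cap i, fun _ => W⟩
  obtain ⟨⟨v, hv⟩, hfit, -⟩ := optimalMatching_spec s (n := n) (m := m) rfl rfl hcap
  exact ⟨_, v, hv, hfit⟩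

theorem exists_supported_fits_capacity {n m : ℕ} (W : ℕ → ℕ → ℝ) (k : ℕ → ℕ) (S : Finset ℕ) :
    ∃ A v, Supported n m W (capacity m k (n + 1) S) A v ∧ Fits n m (capacity m k (n + 1) S) A := by
  refine exists_supported_fits W ?_
  rw [sum_range_succ]
  have : capacity m k (n + 1) S m = n + 1 := by simp [capacity]
  omega

/-! ### The greedy program -/

/-! Registers of the greedy program. While the candidates are examined, `pick` is the best candidate
so far, or `m` if there is none, and `bestMargin` is its marginal value. -/

namespace Arr
abbrev pick : ℕ := 16
abbrev loopCand : ℕ := 24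
abbrev loopGreedy : ℕ := 25
abbrev loopX : ℕ := 26
abbrev loopY : ℕ := 27
abbrev loopZ : ℕ := 28
abbrev base : ℕ := 4
abbrev margin : ℕ := 5
abbrev bestMargin : ℕ := 6
abbrev prodCand : ℕ := 7
abbrev prodPick : ℕ := 8
abbrev best : ℕ := 9
end Arr

/-- The memory holds the data of an instance with `n` students and `m` seminars, where `k c` is
the positive number of students that seminar `c` allows, or `0` if it must stay empty. -/
structure HoldsInst (n m : ℕ) (k : ℕ → ℕ) (W : ℕ → ℕ → ℝ) (s : Store) : Prop where
  students : col s Arr.students 0 = n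
  seminars : col s Arr.seminars 0 = m
  elem : ∀ c, s.nat Arr.elem c 1 = k c
  profit : s.real Arr.profit = W

/-- The capacities in the memory are those for holding the seminars of `S`; the option `m` takes
the students that remain. -/
structure HoldsCap (n m : ℕ) (k : ℕ → ℕ) (S : Finset ℕ) (s : Store) : Prop where
  subset : S ⊆ range m
  cost_le : ∑ c ∈ S, k c ≤ n
  cap : ∀ c ≤ m, col s Arr.cap c = capacity m k (n - ∑ c ∈ S, k c) S c

section

variable {n m : ℕ} {k : ℕ → ℕ} {W : ℕ → ℕ → ℝ} {s : Store} {S : Finset ℕ}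

theorem HoldsInst.run (h : HoldsInst n m k W s) (c : ForProg)
    (hn : ∀ a ∈ [Arr.students, Arr.seminars, Arr.elem], a ∉ c.natWrites)
    (hr : Arr.profit ∉ c.realWrites) : HoldsInst n m k W (c.run s) := by
  refine ⟨?_, ?_, fun d => ?_, ?_⟩
  · rw [col_run _ _ (hn _ (by decide)), h.students]
  · rw [col_run _ _ (hn _ (by decide)), h.seminars]
  · rw [nat_run_of_notMem _ (hn _ (by decide)), h.elem]
  · rw [real_run_of_notMem _ hr, h.profit]

theorem HoldsInst.writeNat (h : HoldsInst n m k W s) {a : ℕ} (ha : Arr.elem < a) (i v : ℕ) :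
    HoldsInst n m k W (s.writeNat a i 0 v) := by
  have ha : 2 < a := ha
  have h0 : Arr.students ≠ a := fun h0 => by rw [← h0] at ha; exact absurd ha (by decide)
  have h1 : Arr.seminars ≠ a := fun h1 => by rw [← h1] at ha; exact absurd ha (by decide)
  refine ⟨?_, ?_, fun d => ?_, h.profit⟩
  · rw [col_writeNat_of_ne _ h0, h.students]
  · rw [col_writeNat_of_ne _ h1, h.seminars]
  · rw [← h.elem]
    simp

theorem HoldsCap.congr {s' : Store} (h : HoldsCap n m k S s)
    (hc : col s' Arr.cap = col s Arr.cap) : HoldsCap n m k S s' :=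
  ⟨h.subset, h.cost_le, by rw [hc]; exact h.cap⟩

theorem optimalMatching_value (hW : ∀ i c, 0 ≤ W i c) (hWm : ∀ i, W i m = 0)
    (h : HoldsInst n m k W s) (hS : HoldsCap n m k S s) :
    rcol (optimalMatching.run s) Arr.val 0 = value n m W k S ∧
    gain n W (col (optimalMatching.run s) Arr.asg) = value n m W k S ∧
    Fits n m (capacity m k (n - ∑ c ∈ S, k c) S) (col (optimalMatching.run s) Arr.asg) := by
  have hcap : n ≤ ∑ c ∈ range (m + 1), col s Arr.cap c := by
    rw [sum_congr rfl fun c hc => hS.cap c (Nat.lt_succ_iff.1 (mem_range.1 hc)),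
      sum_capacity _ hS.subset]
    omega
  obtain ⟨⟨v, hv⟩, hfit, hval⟩ := optimalMatching_spec s h.students h.seminars hcap
  rw [h.profit] at hv hval
  have hfit' := hfit.congr hS.cap
  have hg := (hv.congr hS.cap).gain_eq_optimum hfit'
  rw [optimum_exact hW hWm hS.subset hS.cost_le] at hg
  exact ⟨hval.trans hg, hg, hfit'⟩

/-- The positive number of students that seminar `x` allows. -/
def elemExpr (x : NatExpr) : NatExpr := .get Arr.elem x (.const 1)

@[simp] theorem eval_elemExpr (s : Store) (x : NatExpr) :
    (elemExpr x).eval s = s.nat Arr.elem (x.eval s) 1 := rfl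

/-- The seminar in register `x` is a candidate. -/
def candidateTest (x : ℕ) : Test :=
  .both (.natLe (entry Arr.cap (reg x)) (.const 0))
    (.both (.natLe (.const 1) (elemExpr (reg x)))
      (.natLe (elemExpr (reg x)) (entry Arr.cap (reg Arr.seminars))))

theorem candidateTest_holds (hkm : k m = 0) (h : HoldsInst n m k W s) (hS : HoldsCap n m k S s)
    {a x : ℕ} (hx : col s a 0 = x) (hxm : x ≤ m) :
    (candidateTest a).Holds s ↔ Candidate k n S x := by
  have hm := hS.cap m le_rfl
  have hle := hS.cost_le
  simp only [candidateTest, Test.Holds, eval_entry, eval_reg, NatExpr.eval, eval_elemExpr, hx,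
    h.elem, h.seminars, hm, hS.cap x hxm, Candidate]
  by_cases hxm' : x = m
  · simp [hxm', hkm]
  · by_cases hxS : x ∈ S
    · simp only [capacity, hxm', hxS, if_true, if_false]
      constructor
      · rintro ⟨h1, h2, _⟩
        omega
      · exact fun h => absurd trivial h.1
    · simp only [capacity, hxm', hxS, if_true, if_false]
      simp
      omega

/-- Hold the seminar in register `x`. -/
def holdSeminar (x : ℕ) : ForProg := block [
  setEntry Arr.cap (reg Arr.seminars)
    (.minus (entry Arr.cap (reg Arr.seminars)) (elemExpr (reg x))),
  setEntry Arr.cap (reg x) (elemExpr (reg x))]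

theorem HoldsCap.holdSeminar (h : HoldsInst n m k W s) (hS : HoldsCap n m k S s) {a x : ℕ}
    (ha : a ≠ Arr.cap) (hx : col s a 0 = x) (hxm : x < m) (hc : Candidate k n S x) :
    HoldsCap n m k (insert x S) ((holdSeminar a).run s) := by
  obtain ⟨hxS, h1, h2⟩ := hc
  have he : ∀ y d v, (s.writeNat Arr.cap y 0 v).nat Arr.elem d 1 = k d := fun y d v => by
    simp [h.elem]
  have hcol : col ((SAP.holdSeminar a).run s) Arr.cap =
      Function.update (Function.update (col s Arr.cap) m (col s Arr.cap m - k x)) x (k x) := by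
    have hea : ∀ y v, col (s.writeNat Arr.cap y 0 v) a = col s a :=
      fun y v => col_writeNat_of_ne _ ha _ _
    simp only [SAP.holdSeminar, run_block_cons, run_block_singleton, run_setEntry, eval_reg,
      NatExpr.eval, eval_entry, eval_elemExpr, hea, he, hx, h.seminars, h.elem, col_writeNat_self]
  refine ⟨insert_subset (mem_range.2 hxm) hS.subset, ?_, fun c hc => ?_⟩
  · rw [sum_insert hxS]
    omega
  · rw [hcol, sum_insert hxS]
    by_cases hcx : c = x
    · subst hcx
      simp [capacity, hxm.ne]
    · rw [Function.update_of_ne hcx]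
      by_cases hcm : c = m
      · subst hcm
        rw [Function.update_self, hS.cap c le_rfl]
        simp only [capacity, if_true]
        omega
      · rw [Function.update_of_ne hcm, hS.cap c hc]
        simp [capacity, hcm, hcx]

/-- Hold the seminar in register `x` if it is a candidate. -/
def addOption (x : ℕ) : ForProg := branch (candidateTest x) (holdSeminar x) skip

theorem HoldsCap.addOption (hkm : k m = 0) (h : HoldsInst n m k W s) (hS : HoldsCap n m k S s)
    {a x : ℕ} (ha : a ≠ Arr.cap) (hx : col s a 0 = x) (hxm : x ≤ m) :
    HoldsCap n m k (extend k n S x) ((addOption a).run s) := by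
  have ht := candidateTest_holds hkm h hS hx hxm
  by_cases hc : Candidate k n S x
  · simp only [SAP.addOption, run_branch, if_pos (ht.2 hc), extend, if_pos hc]
    refine hS.holdSeminar h ha hx (lt_of_le_of_ne hxm ?_) hc
    rintro rfl
    have := hc.2.1
    omega
  · simpa only [SAP.addOption, run_branch, if_neg (mt ht.1 hc), extend, if_neg hc, run_skip]
      using hS

/-- Undo `holdSeminar`. -/
def dropSeminar (x : ℕ) : ForProg := block [
  setEntry Arr.cap (reg Arr.seminars)
    (.plus (entry Arr.cap (reg Arr.seminars)) (elemExpr (reg x))),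
  setEntry Arr.cap (reg x) (.const 0)]

theorem HoldsCap.dropSeminar (h : HoldsInst n m k W s) {a x : ℕ}
    (hS : HoldsCap n m k (insert x S) s) (hxS : x ∉ S)
    (ha : a ≠ Arr.cap) (hx : col s a 0 = x) :
    HoldsCap n m k S ((dropSeminar a).run s) := by
  have hxm : x < m := mem_range.1 (hS.subset (mem_insert_self _ _))
  have hcost := hS.cost_le
  rw [sum_insert hxS] at hcost
  have hcol : col ((SAP.dropSeminar a).run s) Arr.cap =
      Function.update (Function.update (col s Arr.cap) m (col s Arr.cap m + k x)) x 0 := by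
    have hea : ∀ y v, col (s.writeNat Arr.cap y 0 v) a = col s a :=
      fun y v => col_writeNat_of_ne _ ha _ _
    simp only [SAP.dropSeminar, run_block_cons, run_block_singleton, run_setEntry, eval_reg,
      NatExpr.eval, eval_entry, eval_elemExpr, hea, hx, h.seminars, h.elem, col_writeNat_self]
  refine ⟨(subset_insert _ _).trans hS.subset, by omega, fun c hc => ?_⟩
  rw [hcol]
  by_cases hcx : c = x
  · subst hcx
    simp [capacity, hxm.ne, hxS]
  · rw [Function.update_of_ne hcx]
    by_cases hcm : c = m
    · subst hcm
      rw [Function.update_self, hS.cap c le_rfl, sum_insert hxS]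
      simp only [capacity, if_true]
      omega
    · rw [Function.update_of_ne hcm, hS.cap c hc]
      simp [capacity, hcm, hcx]

/-- Multiply the marginal values by the numbers of students, by repeated addition. -/
def products : ForProg := block [
  setRReg Arr.prodCand .zero,
  setRReg Arr.prodPick .zero,
  loop Arr.loopStu .students (block [
    branch (.natLe (.plus (reg Arr.loopStu) (.const 1)) (elemExpr (reg Arr.pick)))
      (setRReg Arr.prodCand (.plus (rreg Arr.prodCand) (rreg Arr.margin))) skip,
    branch (.natLe (.plus (reg Arr.loopStu) (.const 1)) (elemExpr (reg Arr.loopCand)))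
      (setRReg Arr.prodPick (.plus (rreg Arr.prodPick) (rreg Arr.bestMargin))) skip])]

theorem min_succ_mul (j l : ℕ) (a : ℝ) :
    ((min (j + 1) l : ℕ) : ℝ) * a = (min j l : ℕ) * a + if j + 1 ≤ l then a else 0 := by
  split_ifs with h
  · rw [min_eq_left h, min_eq_left (by omega)]
    push_cast
    ring
  · rw [min_eq_right (by omega), min_eq_right (by omega), add_zero]

/-- Both numbers of students are at most `n` for candidates, so that the minimum disappears. -/
theorem products_spec (h : HoldsInst n m k W s) :
    rcol (products.run s) Arr.prodCand 0 =
      (min n (k (col s Arr.pick 0)) : ℕ) * rcol s Arr.margin 0 ∧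
    rcol (products.run s) Arr.prodPick 0 =
      (min n (k (col s Arr.loopCand 0)) : ℕ) * rcol s Arr.bestMargin 0 := by
  have key : HoldsInst n m k W (products.run s) ∧
      rcol (products.run s) Arr.prodCand 0 =
        (min n (k (col s Arr.pick 0)) : ℕ) * rcol s Arr.margin 0 ∧
      rcol (products.run s) Arr.prodPick 0 =
        (min n (k (col s Arr.loopCand 0)) : ℕ) * rcol s Arr.bestMargin 0 := by
    refine run_loop_spec rfl _ (N := n) (by simp [h.students])
      (fun j s' => HoldsInst n m k W s' ∧ rcol s' Arr.prodCand 0 =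
        (min j (k (col s Arr.pick 0)) : ℕ) * rcol s Arr.margin 0 ∧
        rcol s' Arr.prodPick 0 =
        (min j (k (col s Arr.loopCand 0)) : ℕ) * rcol s Arr.bestMargin 0)
      (fun j s' v h => ⟨h.1.writeNat (by decide) _ _, by simpa using h.2⟩)
      ⟨(h.run (setRReg Arr.prodCand .zero) (by decide) (by decide)).run
        (setRReg Arr.prodPick .zero) (by decide) (by decide), by simp⟩ ?_
    intro j hj s' ⟨h0, h1, h2⟩ hx hfn hfr
    have e1 : col s' Arr.pick = col s Arr.pick := hfn _ (by decide)
    have e2 : col s' Arr.loopCand = col s Arr.loopCand := hfn _ (by decide)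
    have e3 : rcol s' Arr.margin 0 = rcol s Arr.margin 0 := by
      rw [rcol, hfr _ (by decide)]
      simp [rcol]
    have e4 : rcol s' Arr.bestMargin 0 = rcol s Arr.bestMargin 0 := by
      rw [rcol, hfr _ (by decide)]
      simp [rcol]
    refine ⟨h0.run _ (by decide) (by decide), ?_⟩
    rw [min_succ_mul, min_succ_mul, ← h1, ← h2]
    simp only [run_block_cons, run_block_singleton, run_branch, Test.Holds, eval_reg, NatExpr.eval,
      eval_elemExpr, hx, e1, h0.elem]
    by_cases hc1 : j + 1 ≤ k (col s Arr.pick 0) <;>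
      by_cases hc2 : j + 1 ≤ k (col s Arr.loopCand 0) <;>
      simp [hc1, hc2, hx, e2, e3, e4, h0.elem]
  exact key.2

/-- If the seminar in the counter `loopCand` is a candidate, compute its marginal value, and make it
the new pick if its marginal value per student exceeds that of the old pick. -/
def tryCandidate : ForProg := branch (candidateTest Arr.loopCand)
  (block [
    holdSeminar Arr.loopCand,
    optimalMatching,
    setRReg Arr.margin (.minus (rreg Arr.val) (rreg Arr.base)),
    dropSeminar Arr.loopCand,
    products,
    branch (.both (.natLe (.plus (reg Arr.pick) (.const 1)) (reg Arr.seminars))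
        (.realLe (rreg Arr.prodCand) (rreg Arr.prodPick)))
      skip
      (block [
        setReg Arr.pick (reg Arr.loopCand),
        setRReg Arr.bestMargin (rreg Arr.margin)])])
  skip

/-- The pick is the best among the candidates below `j`; it is `m` if there is none. -/
def Picked (n m : ℕ) (k : ℕ → ℕ) (W : ℕ → ℕ → ℝ) (S : Finset ℕ) (j : ℕ) (s : Store) : Prop :=
  (col s Arr.pick 0 = m ∧ ∀ y < j, ¬ Candidate k n S y) ∨
    (col s Arr.pick 0 < m ∧ Candidate k n S (col s Arr.pick 0) ∧
      rcol s Arr.bestMargin 0 = value n m W k (insert (col s Arr.pick 0) S) - value n m W k S ∧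
      ∀ y < j, Candidate k n S y →
        (value n m W k (insert y S) - value n m W k S) * k (col s Arr.pick 0) ≤
          (value n m W k (insert (col s Arr.pick 0) S) - value n m W k S) * k y)

theorem tryCandidate_spec (hW : ∀ i c, 0 ≤ W i c) (hWm : ∀ i, W i m = 0) (hkm : k m = 0)
    (h : HoldsInst n m k W s) (hS : HoldsCap n m k S s)
    (hbase : rcol s Arr.base 0 = value n m W k S) {j : ℕ} (hj : col s Arr.loopCand 0 = j)
    (hjm : j ≤ m) (hP : Picked n m k W S j s) :
    HoldsCap n m k S (tryCandidate.run s) ∧ Picked n m k W S (j + 1) (tryCandidate.run s) := by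
  have ht := candidateTest_holds hkm h hS hj hjm
  by_cases hc : Candidate k n S j
  swap
  · simp only [tryCandidate, run_branch, if_neg (mt ht.1 hc), run_skip]
    refine ⟨hS, ?_⟩
    rcases hP with ⟨h1, h2⟩ | ⟨h1, h2, h3, h4⟩
    · refine Or.inl ⟨h1, fun y hy => ?_⟩
      rcases Nat.lt_succ_iff_lt_or_eq.1 hy with hy | rfl
      · exact h2 y hy
      · exact hc
    · refine Or.inr ⟨h1, h2, h3, fun y hy hcy => ?_⟩
      rcases Nat.lt_succ_iff_lt_or_eq.1 hy with hy | rfl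
      · exact h4 y hy hcy
      · exact absurd hcy hc
  have hjm' : j < m := lt_of_le_of_ne hjm (by
    rintro rfl
    have := hc.2.1
    omega)
  simp only [tryCandidate, run_branch, if_pos (ht.2 hc), run_block_cons]
  have a1 := h.run (holdSeminar Arr.loopCand) (by decide) (by decide)
  have b1 := hS.holdSeminar h (by decide) hj hjm' hc
  have c1 : col ((holdSeminar Arr.loopCand).run s) Arr.loopCand = col s Arr.loopCand :=
    col_run _ _ (by decide)
  have d1 : col ((holdSeminar Arr.loopCand).run s) Arr.pick = col s Arr.pick :=
    col_run _ _ (by decide)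
  have r1 : ∀ a, rcol ((holdSeminar Arr.loopCand).run s) a = rcol s a :=
    fun a => rcol_run _ _ (by simp [holdSeminar, block, realWrites, setEntry])
  generalize (holdSeminar Arr.loopCand).run s = s₁ at *
  have a2 := a1.run optimalMatching (by decide) (by decide)
  have b2 := b1.congr (col_run optimalMatching _ (by decide))
  have c2 := col_run optimalMatching s₁ (a := Arr.loopCand) (by decide)
  have d2 := col_run optimalMatching s₁ (a := Arr.pick) (by decide)
  have r2 := rcol_run optimalMatching s₁ (a := Arr.base) (by decide)
  have r2' := rcol_run optimalMatching s₁ (a := Arr.bestMargin) (by decide)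
  have v2 := (optimalMatching_value hW hWm a1 b1).1
  generalize optimalMatching.run s₁ = s₂ at *
  set s₃ := (setRReg Arr.margin (.minus (rreg Arr.val) (rreg Arr.base))).run s₂ with hs₃
  have a3 := a2.run (setRReg Arr.margin (.minus (rreg Arr.val) (rreg Arr.base))) (by decide)
    (by decide)
  have b3 : HoldsCap n m k (insert j S) s₃ := b2.congr (by simp [hs₃])
  have c3 : col s₃ = col s₂ := by simp [hs₃]
  have r3 : rcol s₃ Arr.bestMargin = rcol s₂ Arr.bestMargin := by simp [hs₃]
  have v3 : rcol s₃ Arr.margin 0 = value n m W k (insert j S) - value n m W k S := by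
    simp [hs₃, v2, r2, r1, hbase]
  rw [← hs₃] at a3
  clear_value s₃
  have a4 := a3.run (dropSeminar Arr.loopCand) (by decide) (by decide)
  have b4 := b3.dropSeminar a3 hc.1 (a := Arr.loopCand) (by decide) (by rw [c3, c2, c1, hj])
  have c4 := col_run (dropSeminar Arr.loopCand) s₃ (a := Arr.loopCand) (by decide)
  have d4 := col_run (dropSeminar Arr.loopCand) s₃ (a := Arr.pick) (by decide)
  have r4 : ∀ a, rcol ((dropSeminar Arr.loopCand).run s₃) a = rcol s₃ a :=
    fun a => rcol_run _ _ (by simp [dropSeminar, block, realWrites, setEntry])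
  generalize (dropSeminar Arr.loopCand).run s₃ = s₄ at *
  have a5 := a4.run products (by decide) (by decide)
  have b5 := b4.congr (col_run products _ (by decide))
  have c5 := col_run products s₄ (a := Arr.loopCand) (by decide)
  have d5 := col_run products s₄ (a := Arr.pick) (by decide)
  have r5 := rcol_run products s₄ (a := Arr.margin) (by decide)
  have r5' := rcol_run products s₄ (a := Arr.bestMargin) (by decide)
  obtain ⟨p5, q5⟩ := products_spec a4
  generalize products.run s₄ = s₅ at *
  rw [c4, c3, c2, c1] at c5
  rw [d4, c3, d2, d1] at d5
  rw [c4, c3, c2, c1, hj, r4, r3, r2', r1] at q5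
  rw [d4, c3, d2, d1, r4, v3] at p5
  rw [r4] at r5
  rw [r4, r3, r2', r1] at r5'
  simp only [run_block_singleton, run_branch, Test.Holds, eval_reg, NatExpr.eval, eval_rreg,
    a5.seminars, d5, p5, q5]
  have hkj : k j ≤ n := by
    have := hc.2.2
    omega
  rw [min_eq_right hkj]
  have hkj0 : (0 : ℝ) < k j := by exact_mod_cast hc.2.1
  split_ifs with hcond
  · refine ⟨b5, ?_⟩
    rcases hP with ⟨h1, h2⟩ | ⟨h1, h2, h3, h4⟩
    · omega
    · refine Or.inr ?_
      rw [run_skip, d5, r5']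
      refine ⟨h1, h2, h3, fun y hy hcy => ?_⟩
      rcases Nat.lt_succ_iff_lt_or_eq.1 hy with hy | rfl
      · exact h4 y hy hcy
      · have hle := hcond.2
        rw [min_eq_right (by have := h2.2.2; omega), h3] at hle
        linarith
  · refine ⟨b5.congr (by simp), ?_⟩
    have e1 : col ((block [
        setReg Arr.pick (reg Arr.loopCand),
        setRReg Arr.bestMargin (rreg Arr.margin)]).run s₅) Arr.pick 0 = j := by
      simp [c5, hj]
    have e2 : rcol ((block [
        setReg Arr.pick (reg Arr.loopCand),
        setRReg Arr.bestMargin (rreg Arr.margin)]).run s₅) Arr.bestMargin 0 =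
        value n m W k (insert j S) - value n m W k S := by
      simp [r5, v3]
    right
    rw [e1, e2]
    refine ⟨hjm', hc, rfl, fun y hy hcy => ?_⟩
    rcases Nat.lt_succ_iff_lt_or_eq.1 hy with hy | rfl
    swap
    · exact le_rfl
    rcases hP with ⟨h1, h2⟩ | ⟨h1, h2, h3, h4⟩
    · exact absurd hcy (h2 y hy)
    · have h5 := h4 y hy hcy
      have h6 := not_le.1 fun hle => hcond ⟨h1, hle⟩
      rw [min_eq_right (by have := h2.2.2; omega), h3] at h6
      set p := col s Arr.pick 0
      have hkp : (0 : ℝ) < k p := by exact_mod_cast h2.2.1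
      have hky : (0 : ℝ) < k y := by exact_mod_cast hcy.2.1
      refine le_of_mul_le_mul_right ?_ hkp
      calc (value n m W k (insert y S) - value n m W k S) * k j * k p
          = (value n m W k (insert y S) - value n m W k S) * k p * k j := by ring
        _ ≤ (value n m W k (insert p S) - value n m W k S) * k y * k j :=
            mul_le_mul_of_nonneg_right h5 hkj0.le
        _ = (k j * (value n m W k (insert p S) - value n m W k S)) * k y := by ring
        _ ≤ (k p * (value n m W k (insert j S) - value n m W k S)) * k y :=
            mul_le_mul_of_nonneg_right h6.le hky.le
        _ = (value n m W k (insert j S) - value n m W k S) * k y * k p := by ring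

end

/-- One step of the greedy algorithm. If there is no candidate, the pick is the option `m`, which
is not added. -/
def greedyStep : ForProg := block [
  optimalMatching,
  setRReg Arr.base (rreg Arr.val),
  setReg Arr.pick (reg Arr.seminars),
  loop Arr.loopCand .seminars tryCandidate,
  addOption Arr.pick]

/-- The greedy algorithm. -/
def greedy : ForProg := loop Arr.loopGreedy .seminars greedyStep

section

variable {n m : ℕ} {k : ℕ → ℕ} {W : ℕ → ℕ → ℝ} {s : Store} {S : Finset ℕ}

theorem greedyStep_spec (hW : ∀ i c, 0 ≤ W i c) (hWm : ∀ i, W i m = 0) (hkm : k m = 0)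
    (h : HoldsInst n m k W s) (hS : HoldsCap n m k S s) :
    ∃ S', GreedyStep (value n m W k) m k n S S' ∧ HoldsCap n m k S' (greedyStep.run s) := by
  simp only [greedyStep, run_block_cons, run_block_singleton]
  have a1 := h.run optimalMatching (by decide) (by decide)
  have b1 := hS.congr (col_run optimalMatching _ (by decide))
  have v1 := (optimalMatching_value hW hWm h hS).1
  generalize optimalMatching.run s = s₁ at *
  have a2 := (a1.run (setRReg Arr.base (rreg Arr.val)) (by decide) (by decide)).run
    (setReg Arr.pick (reg Arr.seminars)) (by decide) (by decide)
  have b2 : HoldsCap n m k S ((setReg Arr.pick (reg Arr.seminars)).run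
    ((setRReg Arr.base (rreg Arr.val)).run s₁)) := b1.congr (by simp)
  have v2 : rcol ((setReg Arr.pick (reg Arr.seminars)).run
    ((setRReg Arr.base (rreg Arr.val)).run s₁)) Arr.base 0 = value n m W k S := by simp [v1]
  have p2 : col ((setReg Arr.pick (reg Arr.seminars)).run
    ((setRReg Arr.base (rreg Arr.val)).run s₁)) Arr.pick 0 = m := by simp [a1.seminars]
  generalize (setReg Arr.pick (reg Arr.seminars)).run
    ((setRReg Arr.base (rreg Arr.val)).run s₁) = s₂ at *
  have key : ∀ s₃, s₃ = ForProg.run (loop Arr.loopCand .seminars tryCandidate) s₂ →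
      HoldsInst n m k W s₃ ∧ HoldsCap n m k S s₃ ∧ Picked n m k W S (m + 1) s₃ := by
    rintro _ rfl
    refine run_loop_spec rfl s₂ (N := m + 1) (by simp [a2.seminars])
      (fun j s' => HoldsInst n m k W s' ∧ HoldsCap n m k S s' ∧ Picked n m k W S j s')
      (fun j s' v h => ⟨h.1.writeNat (by decide) _ _, h.2.1.congr (by simp),
        by simpa [Picked] using h.2.2⟩)
      ⟨a2, b2, Or.inl ⟨p2, fun y hy => by omega⟩⟩ ?_
    intro j hj s' ⟨h1, h2, h3⟩ hx hfn hfr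
    have hb : rcol s' Arr.base 0 = value n m W k S := by
      rw [rcol, hfr _ (by decide)]
      exact v2
    exact ⟨h1.run _ (by decide) (by decide),
      tryCandidate_spec hW hWm hkm h1 h2 hb hx (by omega) h3⟩
  obtain ⟨a3, b3, p3⟩ := key _ rfl
  generalize ForProg.run (loop Arr.loopCand .seminars tryCandidate) s₂ = s₃ at *
  have hp : col s₃ Arr.pick 0 ≤ m := by rcases p3 with h | h <;> omega
  refine ⟨_, ?_, b3.addOption hkm a3 (a := Arr.pick) (by decide) rfl hp⟩
  rcases p3 with ⟨h1, h2⟩ | ⟨h1, h2, h3, h4⟩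
  · refine Or.inr ⟨fun y hy => h2 y (by omega), if_neg ?_⟩
    exact h2 _ (by omega)
  · exact Or.inl ⟨_, ⟨h1, h2, fun y hy hc => h4 y (by omega) hc⟩, if_pos h2⟩

/-- Each step adds a seminar or finds no candidate, so that after `m + 1` steps no candidate is left. -/
theorem greedy_spec (hW : ∀ i c, 0 ≤ W i c) (hWm : ∀ i, W i m = 0) (hkm : k m = 0)
    (h : HoldsInst n m k W s) (hS : HoldsCap n m k S s) :
    ∃ S', Relation.ReflTransGen (GreedyStep (value n m W k) m k n) S S' ∧
      (∀ y < m, ¬ Candidate k n S' y) ∧ HoldsCap n m k S' (greedy.run s) := by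
  have key : HoldsInst n m k W (greedy.run s) ∧ ∃ S',
      Relation.ReflTransGen (GreedyStep (value n m W k) m k n) S S' ∧
      HoldsCap n m k S' (greedy.run s) ∧
      (m + 1 ≤ S'.card ∨ ∀ y < m, ¬ Candidate k n S' y) := by
    refine run_loop_spec rfl s (N := m + 1) (by simp [h.seminars])
      (fun t s' => HoldsInst n m k W s' ∧ ∃ S',
        Relation.ReflTransGen (GreedyStep (value n m W k) m k n) S S' ∧ HoldsCap n m k S' s' ∧
        (t ≤ S'.card ∨ ∀ y < m, ¬ Candidate k n S' y))
      (fun j s' v h => ?_) ⟨h, S, .refl, hS, Or.inl (Nat.zero_le _)⟩ ?_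
    · obtain ⟨h1, S', h2, h3, h4⟩ := h
      exact ⟨h1.writeNat (by decide) _ _, S', h2, h3.congr (by simp), h4⟩
    · intro t ht s' ⟨h1, S', h2, h3, h4⟩ hx hfn hfr
      obtain ⟨S'', g1, g2⟩ := greedyStep_spec hW hWm hkm h1 h3
      refine ⟨h1.run _ (by decide) (by decide), S'', h2.tail g1, g2, ?_⟩
      rcases g1 with ⟨x, hx, rfl⟩ | ⟨hno, rfl⟩
      · refine Or.inl ?_
        rw [card_insert_of_notMem hx.2.1.1]
        rcases h4 with h4 | h4
        · omega
        · exact absurd hx.2.1 (h4 x hx.1)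
      · exact Or.inr hno
  obtain ⟨_, S', h1, h2, h3⟩ := key
  refine ⟨S', h1, h3.resolve_left fun hcard => ?_, h2⟩
  have := card_le_card h2.subset
  rw [card_range] at this
  omega

/-! ### The algorithm -/

/-- Hold no seminar. -/
def resetCap : ForProg := block [
  loop Arr.loopOpt .seminars (setEntry Arr.cap (reg Arr.loopOpt) (.const 0)),
  setEntry Arr.cap (reg Arr.seminars) (reg Arr.students)]

theorem resetCap_spec (h : HoldsInst n m k W s) : HoldsCap n m k ∅ (resetCap.run s) := by
  simp only [resetCap, run_block_cons, run_block_singleton]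
  have key : ∀ s₁, s₁ = ForProg.run (loop Arr.loopOpt .seminars
      (setEntry Arr.cap (reg Arr.loopOpt) (.const 0))) s →
      HoldsInst n m k W s₁ ∧ ∀ c < m + 1, col s₁ Arr.cap c = 0 := by
    rintro _ rfl
    refine ⟨h.run _ (by decide) (by decide), ?_⟩
    refine run_loop_spec rfl s (N := m + 1) (by simp [h.seminars])
      (fun j s' => ∀ c < j, col s' Arr.cap c = 0)
      (fun j s' v h => by simpa using h) (fun c hc => by omega) ?_
    intro j hj s' h hx hfn hfr c hc
    rcases Nat.lt_succ_iff_lt_or_eq.1 hc with hc | rfl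
    · simp [hx, Function.update_of_ne hc.ne, h c hc]
    · simp [hx]
  obtain ⟨h1, h2⟩ := key _ rfl
  generalize ForProg.run (loop Arr.loopOpt .seminars
    (setEntry Arr.cap (reg Arr.loopOpt) (.const 0))) s = s₁ at *
  refine ⟨empty_subset _, by simp, fun c hc => ?_⟩
  by_cases hcm : c = m
  · simp [capacity, hcm, h1.seminars, h1.students]
  · simp [capacity, hcm, h1.seminars, h2 c (by omega)]

/-- Write the current assignment to the output, if it is better than what is there. -/
def record : ForProg := branch (.realLe (rreg Arr.val) (rreg Arr.best)) skip (block [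
  setRReg Arr.best (rreg Arr.val),
  loop Arr.loopStu .students (branch
    (.natLe (reg Arr.seminars) (entry Arr.asg (reg Arr.loopStu)))
    (setEntry Arr.out (reg Arr.loopStu) (.const 0))
    (setEntry Arr.out (reg Arr.loopStu) (.plus (entry Arr.asg (reg Arr.loopStu)) (.const 1))))])

/-- The output is an assignment that fills the seminars of a set `S`, and `best` is its profit. -/
def Recorded (n m : ℕ) (k : ℕ → ℕ) (W : ℕ → ℕ → ℝ) (s : Store) : Prop :=
  ∃ (S : Finset ℕ) (A : ℕ → ℕ), S ⊆ range m ∧ ∑ c ∈ S, k c ≤ n ∧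
    Fits n m (capacity m k (n - ∑ c ∈ S, k c) S) A ∧ rcol s Arr.best 0 = gain n W A ∧
    ∀ i < n, col s Arr.out i = if A i = m then 0 else A i + 1

theorem Recorded.congr {s' : Store} (h : Recorded n m k W s)
    (h1 : col s' Arr.out = col s Arr.out) (h2 : rcol s' Arr.best = rcol s Arr.best) :
    Recorded n m k W s' := by
  unfold Recorded
  rw [h1, h2]
  exact h

theorem record_spec (h : HoldsInst n m k W s) (hR : Recorded n m k W s) (hS : S ⊆ range m)
    (hk : ∑ c ∈ S, k c ≤ n) (hfit : Fits n m (capacity m k (n - ∑ c ∈ S, k c) S) (col s Arr.asg))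
    (hval : rcol s Arr.val 0 = gain n W (col s Arr.asg)) :
    Recorded n m k W (record.run s) ∧ rcol s Arr.best 0 ≤ rcol (record.run s) Arr.best 0 ∧
      rcol s Arr.val 0 ≤ rcol (record.run s) Arr.best 0 := by
  simp only [record, run_branch]
  by_cases hle : Test.Holds s (.realLe (rreg Arr.val) (rreg Arr.best))
  · simp only [if_pos hle, run_skip]
    exact ⟨hR, le_rfl, hle⟩
  · simp only [if_neg hle, run_block_cons, run_block_singleton]
    set s₁ := (setRReg Arr.best (rreg Arr.val)).run s with hs₁
    have h1 : HoldsInst n m k W s₁ := h.run _ (by decide) (by decide)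
    have hb1 : rcol s₁ Arr.best 0 = rcol s Arr.val 0 := by simp [hs₁]
    have hasg : col s₁ = col s := by simp [hs₁]
    clear_value s₁
    set s₂ := ForProg.run _ s₁ with hs₂
    have hb : rcol s₂ Arr.best 0 = rcol s Arr.val 0 := by
      rw [hs₂, rcol_run _ _ (by decide), hb1]
    have ho : ∀ i < n, col s₂ Arr.out i =
        if col s Arr.asg i = m then 0 else col s Arr.asg i + 1 := by
      rw [hs₂]
      refine run_loop_spec rfl s₁ (N := n) (by simp [h1.students])
        (fun j s' => ∀ i < j, col s' Arr.out i =
          if col s Arr.asg i = m then 0 else col s Arr.asg i + 1)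
        (fun j s' v h => by simpa using h) (fun i hi => by omega) ?_
      intro j hj s' h hx hfn hfr i hi
      have e1 : col s' Arr.asg = col s Arr.asg := by rw [hfn _ (by decide), hasg]
      have e2 : col s' Arr.seminars 0 = m := by rw [hfn _ (by decide), h1.seminars]
      have hjm := hfit.le j hj
      simp only [run_branch, Test.Holds, eval_reg, eval_entry, hx, e1, e2]
      rcases Nat.lt_succ_iff_lt_or_eq.1 hi with hi | rfl
      · rw [← h i hi]
        split_ifs <;> simp [hx, Function.update_of_ne hi.ne]
      · split_ifs with g1 g2 g2
        · simp [hx]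
        · omega
        · omega
        · simp [hx, e1]
    rw [hb]
    exact ⟨⟨S, _, hS, hk, hfit, hb.trans hval, ho⟩, (not_le.1 hle).le, le_rfl⟩

/-- Run the greedy algorithm from the seminars in the counters of the three outer loops. -/
def tryTriple : ForProg := block [
  resetCap,
  addOption Arr.loopX,
  addOption Arr.loopY,
  addOption Arr.loopZ,
  greedy,
  optimalMatching,
  record]

theorem tryTriple_spec (hW : ∀ i c, 0 ≤ W i c) (hWm : ∀ i, W i m = 0) (hkm : k m = 0)
    (h : HoldsInst n m k W s) (hR : Recorded n m k W s) {x y z : ℕ} (hx : col s Arr.loopX 0 = x)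
    (hy : col s Arr.loopY 0 = y) (hz : col s Arr.loopZ 0 = z) (hxm : x ≤ m) (hym : y ≤ m)
    (hzm : z ≤ m) :
    Recorded n m k W (tryTriple.run s) ∧ rcol s Arr.best 0 ≤ rcol (tryTriple.run s) Arr.best 0 ∧
      ∀ O, GreedyStart (value n m W k) m k n O (extend k n (extend k n (extend k n ∅ x) y) z) →
        (1 - Real.exp (-1)) * value n m W k O ≤ rcol (tryTriple.run s) Arr.best 0 := by
  have hcol : ∀ a ∈ [Arr.loopX, Arr.loopY, Arr.loopZ, Arr.out], ∀ s', ∀ c ∈ [resetCap,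
      addOption Arr.loopX, addOption Arr.loopY, addOption Arr.loopZ, greedy, optimalMatching],
      col (c.run s') a = col s' a := by
    intro a ha s' c hc
    refine col_run c s' ?_
    revert c
    revert a
    decide
  have hbest : ∀ s', ∀ c ∈ [resetCap,
      addOption Arr.loopX, addOption Arr.loopY, addOption Arr.loopZ, greedy, optimalMatching],
      rcol (c.run s') Arr.best = rcol s' Arr.best := by
    intro s' c hc
    refine rcol_run c s' ?_
    revert c
    decide
  simp only [tryTriple, run_block_cons, run_block_singleton]
  have h1 := h.run resetCap (by decide) (by decide)
  have h2 := h1.run (addOption Arr.loopX) (by decide) (by decide)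
  have h3 := h2.run (addOption Arr.loopY) (by decide) (by decide)
  have h4 := h3.run (addOption Arr.loopZ) (by decide) (by decide)
  have h5 := h4.run greedy (by decide) (by decide)
  have h6 := h5.run optimalMatching (by decide) (by decide)
  have c1 := resetCap_spec h
  have c2 := c1.addOption hkm h1 (a := Arr.loopX) (by decide)
    (by rw [hcol _ (by simp) _ _ (by simp), hx]) hxm
  have c3 := c2.addOption hkm h2 (a := Arr.loopY) (by decide)
    (by rw [hcol _ (by simp) _ _ (by simp), hcol _ (by simp) _ _ (by simp), hy]) hym
  have c4 := c3.addOption hkm h3 (a := Arr.loopZ) (by decide)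
    (by rw [hcol _ (by simp) _ _ (by simp), hcol _ (by simp) _ _ (by simp),
      hcol _ (by simp) _ _ (by simp), hz]) hzm
  obtain ⟨S, hS1, hS2, c5⟩ := greedy_spec hW hWm hkm h4 c4
  obtain ⟨v1, v2, v3⟩ := optimalMatching_value hW hWm h5 c5
  have o1 : col (optimalMatching.run (greedy.run ((addOption Arr.loopZ).run
      ((addOption Arr.loopY).run ((addOption Arr.loopX).run (resetCap.run s)))))) Arr.out =
        col s Arr.out := by
    rw [hcol _ (by simp) _ _ (by simp), hcol _ (by simp) _ _ (by simp),
      hcol _ (by simp) _ _ (by simp), hcol _ (by simp) _ _ (by simp),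
      hcol _ (by simp) _ _ (by simp), hcol _ (by simp) _ _ (by simp)]
  have o2 : rcol (optimalMatching.run (greedy.run ((addOption Arr.loopZ).run
      ((addOption Arr.loopY).run ((addOption Arr.loopX).run (resetCap.run s)))))) Arr.best =
        rcol s Arr.best := by
    rw [hbest _ _ (by simp), hbest _ _ (by simp), hbest _ _ (by simp), hbest _ _ (by simp),
      hbest _ _ (by simp), hbest _ _ (by simp)]
  have hrec := record_spec h6 (hR.congr o1 o2) c5.subset c5.cost_le v3 (by rw [v1, v2])
  rw [o2, v1] at hrec
  refine ⟨hrec.1, hrec.2.1, fun O hO => le_trans ?_ hrec.2.2⟩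
  have hsub : ∀ {S T : Finset ℕ}, S ⊆ T → ∀ {x : ℕ}, x ∉ T →
      value n m W k (insert x T) + value n m W k S ≤
        value n m W k T + value n m W k (insert x S) := fun hST _ hxT =>
    value_submodular (exists_supported_fits_capacity W k) hST hxT
  exact (GreedyInvariant.steps hsub value_mono (value_nonneg hW) hO hS1).guarantee hsub value_mono
    (value_nonneg hW) hO hS2

/-- The algorithm: try the greedy algorithm from all sets of at most three seminars. The counters also
take the value `m`, which `addOption` ignores. -/
def algorithm : ForProg :=
  loop Arr.loopX .seminars (loop Arr.loopY .seminars (loop Arr.loopZ .seminars tryTriple))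

theorem algorithm_spec_of_start (hW : ∀ i c, 0 ≤ W i c) (hWm : ∀ i, W i m = 0) (hkm : k m = 0)
    (h : HoldsInst n m k W s) (hR : Recorded n m k W s) {x₀ y₀ z₀ : ℕ} (hx₀ : x₀ ≤ m)
    (hy₀ : y₀ ≤ m) (hz₀ : z₀ ≤ m) {O : Finset ℕ}
    (hO : GreedyStart (value n m W k) m k n O
      (extend k n (extend k n (extend k n ∅ x₀) y₀) z₀)) :
    Recorded n m k W (algorithm.run s) ∧
      (1 - Real.exp (-1)) * value n m W k O ≤ rcol (algorithm.run s) Arr.best 0 := by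
  set B := (1 - Real.exp (-1)) * value n m W k O with hB
  -- `best` only increases, so it is enough that it reaches the bound for the triple of counters
  -- `(x₀, y₀, z₀)`
  have hz : ∀ s, HoldsInst n m k W s → Recorded n m k W s → col s Arr.loopX 0 ≤ m →
      col s Arr.loopY 0 ≤ m → ∀ s', s' = ForProg.run (loop Arr.loopZ .seminars tryTriple) s →
      Recorded n m k W s' ∧ rcol s Arr.best 0 ≤ rcol s' Arr.best 0 ∧
        (col s Arr.loopX 0 = x₀ → col s Arr.loopY 0 = y₀ → B ≤ rcol s' Arr.best 0) := by
    rintro s h hR hx hy _ rfl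
    have key : ∀ s', s' = ForProg.run (loop Arr.loopZ .seminars tryTriple) s →
        HoldsInst n m k W s' ∧ Recorded n m k W s' ∧ rcol s Arr.best 0 ≤ rcol s' Arr.best 0 ∧
          (z₀ < m + 1 → col s Arr.loopX 0 = x₀ → col s Arr.loopY 0 = y₀ →
            B ≤ rcol s' Arr.best 0) := by
      rintro _ rfl
      refine run_loop_spec rfl s (N := m + 1) (by simp [h.seminars])
        (fun j s' => HoldsInst n m k W s' ∧ Recorded n m k W s' ∧
          rcol s Arr.best 0 ≤ rcol s' Arr.best 0 ∧
          (z₀ < j → col s Arr.loopX 0 = x₀ → col s Arr.loopY 0 = y₀ → B ≤ rcol s' Arr.best 0))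
        (fun j s' v h => ⟨h.1.writeNat (by decide) _ _, h.2.1.congr (by simp) (by simp),
          by simpa using h.2.2⟩)
        ⟨h, hR, le_rfl, fun h => by omega⟩ ?_
      intro j hj s' ⟨h1, h2, h3, h4⟩ hzj hfn hfr
      have ex : col s' Arr.loopX 0 = col s Arr.loopX 0 := by rw [hfn _ (by decide)]
      have ey : col s' Arr.loopY 0 = col s Arr.loopY 0 := by rw [hfn _ (by decide)]
      obtain ⟨g1, g2, g3⟩ := tryTriple_spec hW hWm hkm h1 h2 ex ey hzj hx hy (by omega)
      refine ⟨h1.run _ (by decide) (by decide), g1, h3.trans g2, fun hlt hxx hyy => ?_⟩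
      rcases Nat.lt_succ_iff_lt_or_eq.1 hlt with hlt | rfl
      · exact (h4 hlt hxx hyy).trans g2
      · rw [hxx, hyy] at g3
        exact g3 O hO
    obtain ⟨-, g1, g2, g3⟩ := key _ rfl
    exact ⟨g1, g2, g3 (by omega)⟩
  have hy : ∀ s, HoldsInst n m k W s → Recorded n m k W s → col s Arr.loopX 0 ≤ m →
      ∀ s', s' = ForProg.run (loop Arr.loopY .seminars (loop Arr.loopZ .seminars tryTriple)) s →
      Recorded n m k W s' ∧ rcol s Arr.best 0 ≤ rcol s' Arr.best 0 ∧
        (col s Arr.loopX 0 = x₀ → B ≤ rcol s' Arr.best 0) := by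
    rintro s h hR hx _ rfl
    have key : ∀ s', s' = ForProg.run (loop Arr.loopY .seminars
        (loop Arr.loopZ .seminars tryTriple)) s →
        HoldsInst n m k W s' ∧ Recorded n m k W s' ∧ rcol s Arr.best 0 ≤ rcol s' Arr.best 0 ∧
          (y₀ < m + 1 → col s Arr.loopX 0 = x₀ → B ≤ rcol s' Arr.best 0) := by
      rintro _ rfl
      refine run_loop_spec rfl s (N := m + 1) (by simp [h.seminars])
        (fun j s' => HoldsInst n m k W s' ∧ Recorded n m k W s' ∧
          rcol s Arr.best 0 ≤ rcol s' Arr.best 0 ∧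
          (y₀ < j → col s Arr.loopX 0 = x₀ → B ≤ rcol s' Arr.best 0))
        (fun j s' v h => ⟨h.1.writeNat (by decide) _ _, h.2.1.congr (by simp) (by simp),
          by simpa using h.2.2⟩)
        ⟨h, hR, le_rfl, fun h => by omega⟩ ?_
      intro j hj s' ⟨h1, h2, h3, h4⟩ hyj hfn hfr
      have ex : col s' Arr.loopX 0 = col s Arr.loopX 0 := by rw [hfn _ (by decide)]
      obtain ⟨g1, g2, g3⟩ := hz s' h1 h2 (by omega) (by omega) _ rfl
      refine ⟨h1.run _ (by decide) (by decide), g1, h3.trans g2, fun hlt hxx => ?_⟩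
      rcases Nat.lt_succ_iff_lt_or_eq.1 hlt with hlt | rfl
      · exact (h4 hlt hxx).trans g2
      · exact g3 (by rw [ex, hxx]) hyj
    obtain ⟨-, g1, g2, g3⟩ := key _ rfl
    exact ⟨g1, g2, g3 (by omega)⟩
  have key : HoldsInst n m k W (algorithm.run s) ∧ Recorded n m k W (algorithm.run s) ∧
      (x₀ < m + 1 → B ≤ rcol (algorithm.run s) Arr.best 0) := by
    refine run_loop_spec rfl s (N := m + 1) (by simp [h.seminars])
      (fun j s' => HoldsInst n m k W s' ∧ Recorded n m k W s' ∧
        (x₀ < j → B ≤ rcol s' Arr.best 0))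
      (fun j s' v h => ⟨h.1.writeNat (by decide) _ _, h.2.1.congr (by simp) (by simp),
        by simpa using h.2.2⟩)
      ⟨h, hR, fun h => by omega⟩ ?_
    intro j hj s' ⟨h1, h2, h3⟩ hxj hfn hfr
    obtain ⟨g1, g2, g3⟩ := hy s' h1 h2 (by omega) _ rfl
    refine ⟨h1.run _ (by decide) (by decide), g1, fun hlt => ?_⟩
    rcases Nat.lt_succ_iff_lt_or_eq.1 hlt with hlt | rfl
    · exact (h3 hlt).trans g2
    · exact g3 hxj
  exact ⟨key.2.1, key.2.2 (by omega)⟩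

/-- The algorithm records an assignment whose profit is within the factor `1 - exp (-1)` of the
value of every set of seminars that can be held. -/
theorem algorithm_spec (hW : ∀ i c, 0 ≤ W i c) (hWm : ∀ i, W i m = 0) (hkm : k m = 0)
    (h : HoldsInst n m k W s) (hR : Recorded n m k W s) {O : Finset ℕ} (hO : O ⊆ range m)
    (hk : ∀ c ∈ O, 1 ≤ k c) (hcost : ∑ c ∈ O, k c ≤ n) :
    Recorded n m k W (algorithm.run s) ∧
      (1 - Real.exp (-1)) * value n m W k O ≤ rcol (algorithm.run s) Arr.best 0 := by
  obtain ⟨x, hx, y, hy, z, hz, hstart⟩ := exists_greedyStart (f := value n m W k)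
    (fun hST _ hxT => value_submodular (exists_supported_fits_capacity W k) hST hxT)
    value_mono (value_nonneg hW) hkm hO hk hcost
  exact algorithm_spec_of_start hW hWm hkm h hR hx hy hz hstart

end

/-! ### Instances with at most two allowable numbers for each seminar -/

/-- In a set of at most two numbers, of which one is `0`, the entry `1` of the sorted list is the other
number. If there is none, it is the default value `0`. -/
theorem getD_sort_mem {K : Finset ℕ} (h0 : 0 ∈ K) (hcard : K.card ≤ 2) :
    (K.sort (· ≤ ·)).getD 1 0 ∈ K ∧ ∀ x ∈ K, x = 0 ∨ x = (K.sort (· ≤ ·)).getD 1 0 := by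
  obtain ⟨L, hL, hK⟩ : ∃ L : Finset ℕ, 0 ∉ L ∧ K = insert 0 L :=
    ⟨K.erase 0, notMem_erase 0 K, (insert_erase h0).symm⟩
  subst hK
  rw [card_insert_of_notMem hL] at hcard
  have hsort : (insert 0 L).sort (· ≤ ·) = 0 :: L.sort (· ≤ ·) :=
    sort_insert (r := (· ≤ ·)) (fun b _ => Nat.zero_le b) hL
  rw [hsort, List.getD_cons_succ]
  rcases Nat.le_one_iff_eq_zero_or_eq_one.1 (by omega : L.card ≤ 1) with h | h
  · rw [card_eq_zero.1 h]
    simp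
  · obtain ⟨a, rfl⟩ := card_eq_one.1 h
    simp

section

variable (P : Inst)

/-- The positive number of students that seminar `c` allows, as stored in the input; it is `0` if
there is none. -/
noncomputable def size (c : ℕ) : ℕ := (input P).nat Arr.elem c 1

/-- The profits as stored in the input: those of the instance, extended by `0`. -/
noncomputable def weight : ℕ → ℕ → ℝ := (input P).real Arr.profit

theorem size_of_lt {c : ℕ} (h : c < P.m) :
    size P c = ((P.K ⟨c, h⟩).sort (· ≤ ·)).getD 1 0 := by
  simp [size, input, h]

theorem size_seminars : size P P.m = 0 := by
  simp [size, input]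

theorem weight_fin (i : Fin P.n) (b : Fin P.m) : weight P i b = P.p i b := by
  simp [weight, input]

theorem weight_seminars (i : ℕ) : weight P i P.m = 0 := by
  simp [weight, input]

theorem weight_nonneg (hp : ∀ i b, 0 ≤ P.p i b) (i c : ℕ) : 0 ≤ weight P i c := by
  simp only [weight, input]
  split_ifs
  · exact hp _ _
  · exact le_rfl

theorem holdsInst_input : HoldsInst P.n P.m (size P) (weight P) (input P) where
  students := by simp [col, input]
  seminars := by simp [col, input]
  elem _ := rfl
  profit := rfl

theorem recorded_input : Recorded P.n P.m (size P) (weight P) (input P) := by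
  refine ⟨∅, fun _ => P.m, empty_subset _, by simp, ⟨fun _ _ => le_rfl, fun c _ => ?_⟩, ?_, ?_⟩
  · by_cases hc : c = P.m
    · simp [capacity, load, hc]
    · simp [load, Ne.symm hc]
  · simp [gain, weight_seminars, rcol, input]
  · intro i _
    simp [col, input]

theorem size_mem {P : Inst} (hK : ∀ b, (P.K b).card ≤ 2) (b : Fin P.m) : size P b ∈ P.K b := by
  rw [size_of_lt P b.2]
  exact (getD_sort_mem (P.zero_mem b) (hK b)).1

theorem eq_zero_or_eq_size {P : Inst} (hK : ∀ b, (P.K b).card ≤ 2) (b : Fin P.m) {x : ℕ}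
    (hx : x ∈ P.K b) : x = 0 ∨ x = size P b := by
  rw [size_of_lt P b.2]
  exact (getD_sort_mem (P.zero_mem b) (hK b)).2 x hx

/-- The assignment as a map into `0, …, m`. -/
def toMap {P : Inst} (A : Assignment P) (i : ℕ) : ℕ :=
  if h : i < P.n then (A ⟨i, h⟩).elim P.m (fun b => b) else P.m

/-- The map into `0, …, m` as an assignment. -/
def ofMap (P : Inst) (A : ℕ → ℕ) : Assignment P :=
  fun i => if h : A i < P.m then some ⟨A i, h⟩ else none

variable {P}

theorem card_filter_fin (n : ℕ) (p : ℕ → Prop) [DecidablePred p] :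
    (univ.filter (fun i : Fin n => p i)).card = ((range n).filter p).card := by
  rw [card_filter, card_filter, ← Fin.sum_univ_eq_sum_range (fun i => if p i then 1 else 0)]

theorem toMap_le (A : Assignment P) (i : ℕ) : toMap A i ≤ P.m := by
  unfold toMap
  split_ifs with h
  · rcases A ⟨i, h⟩ with _ | b
    · exact le_rfl
    · exact b.2.le
  · exact le_rfl

theorem load_toMap (A : Assignment P) (b : Fin P.m) :
    load P.n (toMap A) b = (univ.filter (fun i => A i = some b)).card := by
  rw [load, ← card_filter_fin]
  congr 1
  refine filter_congr fun i _ => ?_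
  rcases h : A i with _ | c
  · simp [toMap, h, b.2.ne']
  · simp [toMap, h, Fin.ext_iff]

theorem load_ofMap (A : ℕ → ℕ) (b : Fin P.m) :
    (univ.filter (fun i => ofMap P A i = some b)).card = load P.n A b := by
  rw [load, ← card_filter_fin]
  congr 1
  refine filter_congr fun i _ => ?_
  unfold ofMap
  split_ifs with h
  · simp [Fin.ext_iff]
  · have := b.2
    simp only [false_iff]
    omega

theorem gain_toMap (A : Assignment P) : gain P.n (weight P) (toMap A) = profit P A := by
  rw [gain, profit, ← Fin.sum_univ_eq_sum_range (fun i => weight P i (toMap A i))]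
  refine sum_congr rfl fun i _ => ?_
  rcases h : A i with _ | b
  · simp [toMap, h, weight_seminars]
  · simp [toMap, h, weight_fin]

theorem gain_ofMap {A : ℕ → ℕ} (hA : ∀ i < P.n, A i ≤ P.m) :
    gain P.n (weight P) A = profit P (ofMap P A) := by
  rw [gain, profit, ← Fin.sum_univ_eq_sum_range (fun i => weight P i (A i))]
  refine sum_congr rfl fun i _ => ?_
  unfold ofMap
  split_ifs with h
  · simpa using weight_fin P i ⟨A i, h⟩
  · rw [le_antisymm (hA i i.2) (not_lt.1 h), weight_seminars]
    rfl

/-- The profit of a feasible assignment is at most the value of the set of seminars that it holds,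
and these can be held simultaneously. -/
theorem Feasible.exists_value (hK : ∀ b, (P.K b).card ≤ 2) {A : Assignment P}
    (hA : Feasible P A) : ∃ O ⊆ range P.m, (∀ c ∈ O, 1 ≤ size P c) ∧
      ∑ c ∈ O, size P c ≤ P.n ∧ profit P A ≤ value P.n P.m (weight P) (size P) O := by
  have hload : ∀ c < P.m, load P.n (toMap A) c = 0 ∨ load P.n (toMap A) c = size P c := by
    intro c hc
    have := load_toMap A ⟨c, hc⟩
    rw [Fin.val_mk] at this
    rw [this]
    exact eq_zero_or_eq_size hK ⟨c, hc⟩ (hA ⟨c, hc⟩)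
  set O := (range P.m).filter (fun c => load P.n (toMap A) c ≠ 0) with hO
  have hOload : ∀ c ∈ O, load P.n (toMap A) c = size P c := fun c hc =>
    (hload c (mem_range.1 (mem_filter.1 hc).1)).resolve_left (mem_filter.1 hc).2
  refine ⟨O, filter_subset _ _, fun c hc => ?_, ?_, ?_⟩
  · rw [← hOload c hc]
    exact Nat.pos_of_ne_zero (mem_filter.1 hc).2
  · rw [← sum_congr rfl hOload]
    refine (sum_le_sum_of_subset (?_ : O ⊆ range (P.m + 1))).trans
      (sum_load fun i _ => toMap_le A i).le
    exact (filter_subset _ _).trans (range_subset_range.2 (Nat.le_succ _))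
  · rw [← gain_toMap]
    refine gain_le_optimum ⟨fun i _ => toMap_le A i, fun c hc => ?_⟩
    by_cases hcm : c = P.m
    · simp only [capacity, if_pos hcm]
      refine (card_filter_le _ _).trans ?_
      simp
    · by_cases hcO : c ∈ O
      · simp [capacity, hcm, hcO, hOload c hcO]
      · have : load P.n (toMap A) c = 0 := by
          by_contra hne
          exact hcO (mem_filter.2 ⟨mem_range.2 (by omega), hne⟩)
        simp [this]

/-- The exact capacities add up to the number of students, so an assignment that respects them fills
the seminars of `S`. -/
theorem Fits.feasible (hK : ∀ b, (P.K b).card ≤ 2) {S : Finset ℕ} {A : ℕ → ℕ}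
    (hS : S ⊆ range P.m) (hk : ∑ c ∈ S, size P c ≤ P.n)
    (hA : Fits P.n P.m (capacity P.m (size P) (P.n - ∑ c ∈ S, size P c) S) A) :
    Feasible P (ofMap P A) := by
  have hsum : ∑ c ∈ range (P.m + 1), load P.n A c = ∑ c ∈ range (P.m + 1),
      capacity P.m (size P) (P.n - ∑ c ∈ S, size P c) S c := by
    rw [sum_load hA.le, sum_capacity _ hS]
    omega
  have heq := (sum_eq_sum_iff_of_le fun c hc =>
    hA.load_le c (Nat.lt_succ_iff.1 (mem_range.1 hc))).1 hsum
  intro b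
  rw [load_ofMap, heq b (mem_range.2 (by omega))]
  simp only [capacity, if_neg b.2.ne]
  split_ifs
  · exact size_mem hK b
  · exact P.zero_mem b

end

theorem wellFormed_algorithm : algorithm.wellFormed := by decide

theorem polyTimeApproximable :
    PolyTimeApproximable {P : Inst | (∀ b, (P.K b).card ≤ 2) ∧ ∀ i b, 0 ≤ P.p i b}
      (1 - Real.exp (-1)) := by
  obtain ⟨q, hq⟩ := algorithm.exists_polynomial wellFormed_algorithm
  refine ⟨algorithm.compile, q, ?_⟩
  rintro P ⟨hK, hp⟩
  obtain ⟨t, ht, hrun⟩ := hq (input P)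
  have hspec := fun O => algorithm_spec (O := O) (weight_nonneg P hp) (weight_seminars P)
    (size_seminars P) (holdsInst_input P) (recorded_input P)
  obtain ⟨S, A, hS, hk, hfit, hbest, hout⟩ := (hspec ∅ (by simp) (by simp) (by simp)).1
  refine ⟨algorithm.run (input P), t, ofMap P A, hrun, ?_, fun i => ?_, hfit.feasible hK hS hk,
    fun A' hA' => ?_⟩
  · simpa [input] using ht
  · refine (hout i i.2).trans ?_
    have := hfit.le i i.2
    unfold ofMap
    split_ifs with h1 h2 h2
    · omega
    · rfl
    · rfl
    · omega
  · obtain ⟨O, hO, hOk, hcost, hle⟩ := hA'.exists_value hK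
    rw [← gain_ofMap hfit.le, ← hbest]
    refine le_trans (mul_le_mul_of_nonneg_left hle ?_) (hspec O hO hOk hcost).2
    have : Real.exp (-1) ≤ 1 := Real.exp_le_one_iff.2 (by norm_num)
    linarith

end SAP

theorem theorem3 :
    SAP.PolyTimeApproximable
      {P : SAP.Inst | (∀ b, (P.K b).card ≤ 2) ∧ ∀ i b, 0 ≤ P.p i b}
      (1 - Real.exp (-1)) :=
  SAP.polyTimeApproximable
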